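/- Fix $\epsilon$ with $0<\epsilon<1/2$. For a Boolean function $f:\mathcal X\times\mathcal Y\to\{0,1\}$ on finite sets and reals $a,b$, let $M_f^{a,b}$ be the $\mathcal X\times\mathcal Y$ matrix with entry $b$ where $f=1$ and $a$ where $f=0$; so $M_f^{0,1}$ is the Boolean and $M_f^{1,-1}$ the sign communication matrix. Let $\gamma_2(M)=\min_{AB=M}\|A\|_r\|B\|_c$, where $\|A\|_r$ is the largest $\ell_2$ norm of a row of $A$ and $\|B\|_c$ the largest $\ell_2$ norm of a column of $B$. Let $R^{pub}_{=\epsilon}(f)$ be the minimal worst-case number of bits sent in a public-coin two-party protocol that accepts every 1-input with probability exactly $1-\epsilon$ and every 0-input with probability exactly $\epsilon$. Let $Q^*_{=\epsilon}(f)$ be the minimal number of qubits sent in a two-party quantum protocol with arbitrary finite-dimensional prior entanglement and with the same requirement on the acceptance probabilities; in it the order of the messages is fixed, the players apply isometries that depend on their inputs, and one of them measures an output qubit at the end. **Theorem.** 1. For all finite $\mathcal X,\mathcal Y$ and all $f:\mathcal X\times\mathcal Y\to\{0,1\}$, protocols of both kinds exist for $f$ (so both complexities are finite), and $$Q^*_{=\epsilon}(f)\le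 R^{pub}_{=\epsilon}(f),\qquad \gamma_2\big(M_f^{\epsilon,1-\epsilon}\big)\le 2^{Q^*_{=\epsilon}(f)}.$$ 2. There is a constant $C>0$ that depends only on $\epsilon$ such that for all finite $\mathcal X,\mathcal Y$, all $f:\mathcal X\times\mathcal Y\to\{0,1\}$, and both $M=M_f^{0,1}$ and $M=M_f^{1,-1}$, $$R^{pub}_{=\epsilon}(f)\le C\,\gamma_2(M)^2,\qquad \gamma_2(M)\le C\,2^{Q^*_{=\epsilon}(f)}.$$ 3. Consequently the measures are constant-equivalent: for every family $(f_n)_n$ of functions $f_n:\{0,1\}^n\times\{0,1\}^n\to\{0,1\}$, the statements $\gamma_2(M_{f_n}^{0,1})=O(1)$, $\gamma_2(M_{f_n}^{1,-1})=O(1)$, $R^{pub}_{=\epsilon}(f_n)=O(1)$ and $Q^*_{=\epsilon}(f_n)=O(1)$ are equivalent. -/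

import Mathlib

open Filter Asymptotics

namespace CommComplexity

/-! ### The factorization norm -/

/-- The largest Euclidean norm of a row of `A` (the index type `X` is finite). -/
noncomputable def maxRowNorm {X : Type} [Finite X] {k : ℕ} (A : Matrix X (Fin k) ℝ) : ℝ :=
  ⨆ x : X, √(∑ i, A x i ^ 2)

/-- The largest Euclidean norm of a column of `B` (the index type `Y` is finite). -/
noncomputable def maxColNorm {Y : Type} [Finite Y] {k : ℕ} (B : Matrix (Fin k) Y ℝ) : ℝ :=
  ⨆ y : Y, √(∑ i, B i y ^ 2)

/-- The `γ₂` norm: the minimum of `‖A‖_r * ‖B‖_c` over all factorizations `A * B = M`. -/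
noncomputable def gammaTwo {X Y : Type} [Finite X] [Finite Y] (M : Matrix X Y ℝ) : ℝ :=
  sInf {c : ℝ | ∃ (k : ℕ) (A : Matrix X (Fin k) ℝ) (B : Matrix (Fin k) Y ℝ),
    A * B = M ∧ c = maxRowNorm A * maxColNorm B}

/-- The communication matrix of `f` with the value `a` at the 0-inputs and `b` at the 1-inputs.
`commMatrix 0 1 f` is the Boolean matrix, `commMatrix 1 (-1) f` the sign matrix of `f`. -/
def commMatrix {X Y : Type} (a b : ℝ) (f : X → Y → Bool) : Matrix X Y ℝ :=
  Matrix.of fun x y => if f x y = true then b else a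

/-! ### Classical protocols -/

/-- Deterministic two-party protocol trees. At an inner node one of the players sends a bit that
depends on that player's input and on the node; a leaf carries the output. -/
inductive DetProtocol (X Y : Type) : Type
  | leaf (out : Bool) : DetProtocol X Y
  | alice (bit : X → Bool) (next : Bool → DetProtocol X Y) : DetProtocol X Y
  | bob (bit : Y → Bool) (next : Bool → DetProtocol X Y) : DetProtocol X Y

namespace DetProtocol

variable {X Y : Type}

/-- The output on input `(x, y)`. -/
def eval : DetProtocol X Y → X → Y → Bool
  | leaf out, _, _ => out
  | alice bit next, x, y => (next (bit x)).eval x y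
  | bob bit next, x, y => (next (bit y)).eval x y

/-- The depth of the tree, which is the number of bits sent in the worst case. -/
def cost : DetProtocol X Y → ℕ
  | leaf _ => 0
  | alice _ next => max (next false).cost (next true).cost + 1
  | bob _ next => max (next false).cost (next true).cost + 1

end DetProtocol

/-- A public-coin protocol: both players see the outcome `i` of a random experiment with
distribution `prob`, and then follow the deterministic protocol `tree i`. -/
structure PublicCoinProtocol (X Y : Type) where
  size : ℕ
  prob : Fin size → ℝ
  prob_mem : prob ∈ stdSimplex ℝ (Fin size)
  tree : Fin size → DetProtocol X Y

namespace PublicCoinProtocol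

variable {X Y : Type}

/-- The number of bits sent, in the worst case over the coins and the inputs. -/
def cost (p : PublicCoinProtocol X Y) : ℕ :=
  Finset.univ.sup fun i => (p.tree i).cost

/-- The probability that the output is `1`. -/
def acceptProb (p : PublicCoinProtocol X Y) (x : X) (y : Y) : ℝ :=
  ∑ i, if (p.tree i).eval x y = true then p.prob i else 0

end PublicCoinProtocol

/-! ### Quantum protocols with prior entanglement -/

/-- `U` is the matrix of an isometry from `ℂⁿ` to `ℂᵐ`. -/
def IsIsometryMatrix {m n : Type} [Fintype m] (U : Matrix m n ℂ) : Prop :=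
  open Classical in U.conjTranspose * U = 1

/-- The interactive part of a two-party quantum protocol, with qubit messages, for players whose
current registers have the orthonormal bases `A` (Alice) and `B` (Bob).

* `aliceSends U`: Alice, with input `x`, applies the isometry `U x` from her register to a new
  register `A'` together with a message qubit, and sends the qubit, which becomes part of Bob's
  register;
* `aliceOutputs U`: Alice applies the isometry `U x` from her register to a new register `A'`
  together with an output qubit; measuring that qubit in the standard basis gives the output.

The constructors for Bob are symmetric. A message of `k` qubits is sent in `k` consecutive steps. -/
inductive QuantumProtocol (X Y : Type) : Type → Type → Type 1
  | aliceSends {A B A' : Type} [Fintype A'] (U : X → Matrix (A' × Bool) A ℂ)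
      (isometry : ∀ x, IsIsometryMatrix (U x)) (next : QuantumProtocol X Y A' (B × Bool)) :
      QuantumProtocol X Y A B
  | bobSends {A B B' : Type} [Fintype B'] (V : Y → Matrix (B' × Bool) B ℂ)
      (isometry : ∀ y, IsIsometryMatrix (V y)) (next : QuantumProtocol X Y (A × Bool) B') :
      QuantumProtocol X Y A B
  | aliceOutputs {A B A' : Type} [Fintype A'] (U : X → Matrix (A' × Bool) A ℂ)
      (isometry : ∀ x, IsIsometryMatrix (U x)) : QuantumProtocol X Y A B
  | bobOutputs {A B B' : Type} [Fintype B'] (V : Y → Matrix (B' × Bool) B ℂ)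
      (isometry : ∀ y, IsIsometryMatrix (V y)) : QuantumProtocol X Y A B

namespace QuantumProtocol

variable {X Y : Type}

/-- The number of qubits sent. -/
def cost : {A B : Type} → QuantumProtocol X Y A B → ℕ
  | _, _, aliceSends _ _ next => next.cost + 1
  | _, _, bobSends _ _ next => next.cost + 1
  | _, _, aliceOutputs _ _ => 0
  | _, _, bobOutputs _ _ => 0

/-- The probability that the output is `1` on input `(x, y)`, when the joint state of the two
registers has the amplitudes `ψ a b`. -/
noncomputable def acceptProb (x : X) (y : Y) : {A B : Type} → [Fintype A] → [Fintype B] →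
    QuantumProtocol X Y A B → (A → B → ℂ) → ℝ
  | _, _, _, _, aliceSends U _ next, ψ =>
      next.acceptProb x y fun a' bm => ∑ a, U x (a', bm.2) a * ψ a bm.1
  | _, _, _, _, bobSends V _ next, ψ =>
      next.acceptProb x y fun am b' => ∑ b, V y (b', am.2) b * ψ am.1 b
  | _, _, _, _, aliceOutputs U _, ψ => ∑ a', ∑ b, ‖∑ a, U x (a', true) a * ψ a b‖ ^ 2
  | _, _, _, _, bobOutputs V _, ψ => ∑ a, ∑ b', ‖∑ b, V y (b', true) b * ψ a b‖ ^ 2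

end QuantumProtocol

/-- A quantum protocol with prior entanglement: the players start with an arbitrary pure state `ψ`
of two finite-dimensional registers, which does not depend on the inputs. -/
structure EntangledProtocol (X Y : Type) where
  A : Type
  B : Type
  [fintypeA : Fintype A]
  [fintypeB : Fintype B]
  ψ : A → B → ℂ
  norm_eq_one : ∑ a, ∑ b, ‖ψ a b‖ ^ 2 = 1
  interaction : QuantumProtocol X Y A B

namespace EntangledProtocol

variable {X Y : Type}

/-- The number of qubits sent; the prior entanglement is free. -/
def cost (p : EntangledProtocol X Y) : ℕ := p.interaction.cost

/-- The probability that the output is `1` on input `(x, y)`. -/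
noncomputable def acceptProb (p : EntangledProtocol X Y) (x : X) (y : Y) : ℝ :=
  letI := p.fintypeA
  letI := p.fintypeB
  p.interaction.acceptProb x y p.ψ

end EntangledProtocol

/-! ### Complexity with oblivious, exact error -/

/-- The acceptance probability is exactly `1 - ε` on all 1-inputs and exactly `ε` on all
0-inputs of `f`. -/
def HasExactError {X Y : Type} (ε : ℝ) (f : X → Y → Bool) (P : X → Y → ℝ) : Prop :=
  ∀ x y, P x y = if f x y = true then 1 - ε else ε

/-- The possible costs of public-coin protocols for `f` with exact error `ε`. -/
def publicCoinCosts {X Y : Type} (ε : ℝ) (f : X → Y → Bool) : Set ℕ :=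
  {c | ∃ p : PublicCoinProtocol X Y, HasExactError ε f p.acceptProb ∧ p.cost = c}

/-- The possible costs of entangled quantum protocols for `f` with exact error `ε`. -/
def entangledCosts {X Y : Type} (ε : ℝ) (f : X → Y → Bool) : Set ℕ :=
  {c | ∃ p : EntangledProtocol X Y, HasExactError ε f p.acceptProb ∧ p.cost = c}

/-- Public-coin randomized communication complexity with oblivious exact error `ε`. -/
noncomputable def exactRpub {X Y : Type} (ε : ℝ) (f : X → Y → Bool) : ℕ :=
  sInf (publicCoinCosts ε f)

/-- Entangled quantum communication complexity with oblivious exact error `ε`. -/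
noncomputable def exactQstar {X Y : Type} (ε : ℝ) (f : X → Y → Bool) : ℕ :=
  sInf (entangledCosts ε f)

end CommComplexity

/-! The inequalities form a cycle: small `γ₂` gives a short public-coin protocol, such a protocol
can be simulated with entanglement, and a short entangled protocol gives small `γ₂`.

From `γ₂` to public coins: by Grothendieck's inequality (`FactorsWithin.mem_smul_signHull`) the sign
matrix, divided by a multiple `100 * c` of its norm bound `c`, is a convex combination of rank-one
sign matrices. Sampling a term of the combination and comparing one sign of each player guesses `f x
y` with the same advantage `1 / (100 * c)` on every input. A majority vote over order `c ^ 2`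
samples brings the error below `ε`. The error is still identical on all inputs, so flipping the
answer with a suitable probability makes it exactly `ε` (`exactRpub_le_of_factorsWithin`).

From public coins to entanglement (`exists_entangledProtocol`): shared diagonal states supply the
coins. Superdense coding puts two classical bits into a qubit. This compensates for the fixed,
alternating order of the messages, so the cost does not grow.

From entanglement to `γ₂` (`QuantumProtocol.hasTensorDecomposition`): the acceptance operator is
pulled back through the protocol, last message first. It stays a sum of tensor products of an
operator depending on `x` and one depending on `y`, and each qubit doubles the bounds on the two
families. Applied to the initial state, the families become the rows and columns of a factorization
of the acceptance matrix. The Boolean, sign and `ε`/`1 - ε` matrices are affine images of one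
another, which costs only constants. -/

namespace CommComplexity

/-! ### Elementary properties of the factorization norm -/

/-- `M` factors through a finite index set, with squared row norms and squared column norms
at most `c`. -/
def FactorsWithin {X Y : Type} (M : X → Y → ℝ) (c : ℝ) : Prop :=
  ∃ (K : Type) (_ : Fintype K) (A : X → K → ℝ) (B : Y → K → ℝ),
    (∀ x y, M x y = ∑ i, A x i * B y i) ∧ (∀ x, ∑ i, A x i ^ 2 ≤ c) ∧ ∀ y, ∑ i, B y i ^ 2 ≤ c

section Gamma

variable {X Y : Type}

/-- Concatenating the vectors adds both their inner products and their squared norms. -/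
theorem FactorsWithin.add {M N : X → Y → ℝ} {c d : ℝ} (hM : FactorsWithin M c)
    (hN : FactorsWithin N d) : FactorsWithin (fun x y => M x y + N x y) (c + d) := by
  obtain ⟨K, _, A, B, h, hA, hB⟩ := hM
  obtain ⟨L, _, A', B', h', hA', hB'⟩ := hN
  refine ⟨K ⊕ L, inferInstance, fun x => Sum.elim (A x) (A' x), fun y => Sum.elim (B y) (B' y),
    fun x y => ?_, fun x => ?_, fun y => ?_⟩
  · simp [h, h']
  · simpa using add_le_add (hA x) (hA' x)
  · simpa using add_le_add (hB y) (hB' y)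

theorem FactorsWithin.smul {M : X → Y → ℝ} {c : ℝ} (hM : FactorsWithin M c) (a : ℝ) :
    FactorsWithin (fun x y => a * M x y) (|a| * c) := by
  obtain ⟨K, _, A, B, h, hA, hB⟩ := hM
  have hs : √|a| ^ 2 = |a| := Real.sq_sqrt (abs_nonneg a)
  refine ⟨K, inferInstance, fun x i => √|a| * A x i, fun y i => SignType.sign a * √|a| * B y i,
    fun x y => ?_, fun x => ?_, fun y => ?_⟩
  · simp only [h, Finset.mul_sum]
    refine Finset.sum_congr rfl fun i _ => ?_
    have : a = SignType.sign a * √|a| ^ 2 := by rw [hs, sign_mul_abs]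
    conv_lhs => rw [this]
    ring
  · simp_rw [mul_pow, hs, ← Finset.mul_sum]
    exact mul_le_mul_of_nonneg_left (hA x) (abs_nonneg a)
  · rcases eq_or_ne a 0 with rfl | ha
    · simp
    · have h1 : ((SignType.sign a : SignType) : ℝ) ^ 2 = 1 := by
        rcases lt_or_gt_of_ne ha with h | h <;> simp [h]
      simp_rw [mul_pow, hs, h1, one_mul, ← Finset.mul_sum]
      exact mul_le_mul_of_nonneg_left (hB y) (abs_nonneg a)

theorem factorsWithin_const_one : FactorsWithin (fun (_ : X) (_ : Y) => (1 : ℝ)) 1 :=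
  ⟨Unit, inferInstance, fun _ _ => 1, fun _ _ => 1, by simp, by simp, by simp⟩

theorem FactorsWithin.congr {M N : X → Y → ℝ} {c d : ℝ} (hM : FactorsWithin M c)
    (h : ∀ x y, N x y = M x y) (hcd : c ≤ d) : FactorsWithin N d := by
  obtain ⟨K, _, A, B, h', hA, hB⟩ := hM
  exact ⟨K, inferInstance, A, B, fun x y => (h x y).trans (h' x y), fun x => (hA x).trans hcd,
    fun y => (hB y).trans hcd⟩

variable [Finite X] [Finite Y]

theorem maxRowNorm_nonneg {k : ℕ} (A : Matrix X (Fin k) ℝ) : 0 ≤ maxRowNorm A :=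
  Real.iSup_nonneg fun _ => Real.sqrt_nonneg _

theorem maxColNorm_nonneg {k : ℕ} (B : Matrix (Fin k) Y ℝ) : 0 ≤ maxColNorm B :=
  Real.iSup_nonneg fun _ => Real.sqrt_nonneg _

theorem sum_sq_le_maxRowNorm_sq {k : ℕ} (A : Matrix X (Fin k) ℝ) (x : X) :
    ∑ i, A x i ^ 2 ≤ maxRowNorm A ^ 2 := by
  rw [← Real.sqrt_le_left (maxRowNorm_nonneg A)]
  exact le_ciSup (f := fun x => √(∑ i, A x i ^ 2)) (Set.finite_range _).bddAbove x

theorem sum_sq_le_maxColNorm_sq {k : ℕ} (B : Matrix (Fin k) Y ℝ) (y : Y) :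
    ∑ i, B i y ^ 2 ≤ maxColNorm B ^ 2 := by
  rw [← Real.sqrt_le_left (maxColNorm_nonneg B)]
  exact le_ciSup (f := fun y => √(∑ i, B i y ^ 2)) (Set.finite_range _).bddAbove y

theorem bddBelow_factorizationCosts (M : Matrix X Y ℝ) :
    BddBelow {c : ℝ | ∃ (k : ℕ) (A : Matrix X (Fin k) ℝ) (B : Matrix (Fin k) Y ℝ),
      A * B = M ∧ c = maxRowNorm A * maxColNorm B} := by
  refine ⟨0, ?_⟩
  rintro _ ⟨k, A, B, _, rfl⟩
  exact mul_nonneg (maxRowNorm_nonneg A) (maxColNorm_nonneg B)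

theorem factorizationCosts_nonempty (M : Matrix X Y ℝ) :
    {c : ℝ | ∃ (k : ℕ) (A : Matrix X (Fin k) ℝ) (B : Matrix (Fin k) Y ℝ),
      A * B = M ∧ c = maxRowNorm A * maxColNorm B}.Nonempty := by
  classical
  have := Fintype.ofFinite X
  let e := Fintype.equivFin X
  refine ⟨_, Fintype.card X, Matrix.of fun x i => if e x = i then 1 else 0,
    Matrix.of fun i y => M (e.symm i) y, ?_, rfl⟩
  ext x y
  simp [Matrix.mul_apply]

theorem gammaTwo_nonneg (M : Matrix X Y ℝ) : 0 ≤ gammaTwo M := by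
  refine Real.sInf_nonneg ?_
  rintro _ ⟨k, A, B, _, rfl⟩
  exact mul_nonneg (maxRowNorm_nonneg A) (maxColNorm_nonneg B)

theorem FactorsWithin.gammaTwo_le {M : Matrix X Y ℝ} {c : ℝ} (hc : 0 ≤ c)
    (hM : FactorsWithin M c) : gammaTwo M ≤ c := by
  obtain ⟨K, _, A, B, h, hA, hB⟩ := hM
  let e := Fintype.equivFin K
  have hA' : maxRowNorm (Matrix.of fun x i => A x (e.symm i)) ≤ √c := by
    refine Real.iSup_le (fun x => Real.sqrt_le_sqrt ?_) (Real.sqrt_nonneg _)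
    simpa [Equiv.sum_comp e.symm fun i => A x i ^ 2] using hA x
  have hB' : maxColNorm (Matrix.of fun i y => B y (e.symm i)) ≤ √c := by
    refine Real.iSup_le (fun y => Real.sqrt_le_sqrt ?_) (Real.sqrt_nonneg _)
    simpa [Equiv.sum_comp e.symm fun i => B y i ^ 2] using hB y
  refine (csInf_le (bddBelow_factorizationCosts M) ⟨_, _, _, ?_, rfl⟩).trans
    ((mul_le_mul hA' hB' (maxColNorm_nonneg _) (Real.sqrt_nonneg _)).trans_eq
      (Real.mul_self_sqrt hc))
  ext x y
  simp [Matrix.mul_apply, h x y, Equiv.sum_comp e.symm fun i => A x i * B y i]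

theorem abs_le_gammaTwo (M : Matrix X Y ℝ) (x : X) (y : Y) : |M x y| ≤ gammaTwo M := by
  refine le_csInf (factorizationCosts_nonempty M) ?_
  rintro _ ⟨k, A, B, rfl, rfl⟩
  refine abs_le_of_sq_le_sq ?_ (mul_nonneg (maxRowNorm_nonneg A) (maxColNorm_nonneg B))
  rw [Matrix.mul_apply, mul_pow]
  exact (Finset.sum_mul_sq_le_sq_mul_sq _ _ _).trans
    (mul_le_mul (sum_sq_le_maxRowNorm_sq A x) (sum_sq_le_maxColNorm_sq B y)
      (Finset.sum_nonneg fun _ _ => sq_nonneg _) (sq_nonneg _))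

/-- The strict inequality makes it unnecessary to know that the infimum is attained. Rescaling the
two factors in opposite directions balances their norms. -/
theorem factorsWithin_of_gammaTwo_lt {M : Matrix X Y ℝ} {c : ℝ} (h : gammaTwo M < c) :
    FactorsWithin M c := by
  have hc : 0 < c := (gammaTwo_nonneg M).trans_lt h
  obtain ⟨_, ⟨k, A, B, rfl, rfl⟩, hlt⟩ := exists_lt_of_csInf_lt (factorizationCosts_nonempty M) h
  have ha := maxRowNorm_nonneg A
  have hb := maxColNorm_nonneg B
  have hA := sum_sq_le_maxRowNorm_sq A
  have hB := sum_sq_le_maxColNorm_sq B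
  set a := maxRowNorm A
  set b := maxColNorm B
  -- If one factor vanishes, Cauchy–Schwarz gives `M = 0` and no coordinates are needed; otherwise
  -- the scaling `√(b / a)` brings both squared norms to `a * b`.
  by_cases hab : a * b = 0
  · refine ⟨Empty, inferInstance, fun _ => Empty.elim, fun _ => Empty.elim, fun x y => ?_,
      by simp [hc.le], by simp [hc.le]⟩
    have h0 : (∑ i, A x i * B i y) ^ 2 ≤ 0 := by
      refine (Finset.sum_mul_sq_le_sq_mul_sq _ _ _).trans ((mul_le_mul (hA x) (hB y)
        (Finset.sum_nonneg fun _ _ => sq_nonneg _) (sq_nonneg _)).trans_eq ?_)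
      rw [← mul_pow, hab]; norm_num
    simpa [Matrix.mul_apply] using pow_eq_zero_iff two_ne_zero |>.1
      (le_antisymm h0 (sq_nonneg _))
  · have ha' : 0 < a := ha.lt_of_ne (by rintro h; simp [← h] at hab)
    have hb' : 0 < b := hb.lt_of_ne (by rintro h; simp [← h] at hab)
    have e1 : √(b / a) ^ 2 = b / a := Real.sq_sqrt (by positivity)
    have e2 : √(b / a) ≠ 0 := by positivity
    refine ⟨Fin k, inferInstance, fun x i => √(b / a) * A x i, fun y i => (√(b / a))⁻¹ * B i y,
      fun x y => ?_, fun x => ?_, fun y => ?_⟩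
    · rw [Matrix.mul_apply]
      refine Finset.sum_congr rfl fun i _ => ?_
      field_simp
    · simp_rw [mul_pow, e1, ← Finset.mul_sum]
      refine (mul_le_mul_of_nonneg_left (hA x) (by positivity)).trans (le_trans (le_of_eq ?_) hlt.le)
      field_simp
    · simp_rw [mul_pow, inv_pow, e1, ← Finset.mul_sum]
      refine (mul_le_mul_of_nonneg_left (hB y) (by positivity)).trans (le_trans (le_of_eq ?_) hlt.le)
      field_simp

end Gamma

/-! ### Grothendieck's inequality -/

section Grothendieck

open Pointwise

variable (X Y : Type)

/-- The convex hull of the rank-one sign matrices. -/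
def signHull : Set (X → Y → ℝ) :=
  convexHull ℝ {M | ∃ a : X → ℝ, (∀ x, a x ∈ ({-1, 1} : Set ℝ)) ∧
    ∃ b : Y → ℝ, (∀ y, b y ∈ ({-1, 1} : Set ℝ)) ∧ M = fun x y => a x * b y}

variable {X Y}

theorem convex_signHull : Convex ℝ (signHull X Y) := convex_convexHull ℝ _

/-- The cube is a product of segments, and the convex hull commutes with products. -/
theorem mem_convexHull_signs {X : Type} [Finite X] {a : X → ℝ} (ha : ∀ x, |a x| ≤ 1) :
    a ∈ convexHull ℝ {s : X → ℝ | ∀ x, s x ∈ ({-1, 1} : Set ℝ)} := by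
  have h : {s : X → ℝ | ∀ x, s x ∈ ({-1, 1} : Set ℝ)} =
      Set.univ.pi fun _ => ({-1, 1} : Set ℝ) := by
    ext; simp
  rw [h, convexHull_pi]
  intro x _
  rw [convexHull_pair, segment_eq_Icc (by norm_num)]
  exact abs_le.1 (ha x)

theorem FactorsWithin.abs_le {M : X → Y → ℝ} {c : ℝ} (hM : FactorsWithin M c) (x : X) (y : Y) :
    |M x y| ≤ c := by
  obtain ⟨K, _, A, B, h, hA, hB⟩ := hM
  have hc : 0 ≤ c := (Finset.sum_nonneg fun i _ => sq_nonneg (A x i)).trans (hA x)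
  refine abs_le_of_sq_le_sq ?_ hc
  rw [h, sq c]
  exact (Finset.sum_mul_sq_le_sq_mul_sq _ _ _).trans
    (mul_le_mul (hA x) (hB y) (Finset.sum_nonneg fun _ _ => sq_nonneg _) hc)

theorem FactorsWithin.of_mul_le {M : X → Y → ℝ} {K : Type} [Fintype K] {A : X → K → ℝ}
    {B : Y → K → ℝ} {a c : ℝ} (ha : a ≠ 0) (hM : ∀ x y, M x y = ∑ i, A x i * B y i)
    (hA : ∀ x, a ^ 2 * ∑ i, A x i ^ 2 ≤ c) (hB : ∀ y, ∑ i, B y i ^ 2 ≤ c * a ^ 2) :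
    FactorsWithin M c := by
  refine ⟨K, inferInstance, fun x i => a * A x i, fun y i => a⁻¹ * B y i, fun x y => ?_,
    fun x => ?_, fun y => ?_⟩
  · rw [hM]
    exact Finset.sum_congr rfl fun i _ => by field_simp
  · simpa only [mul_pow, ← Finset.mul_sum] using hA x
  · simp only [mul_pow, ← Finset.mul_sum]
    rw [inv_pow, inv_mul_le_iff₀ (by positivity), mul_comm]
    exact hB y

theorem add_mem_smul_signHull {M N : X → Y → ℝ} {p q : ℝ} (hp : 0 ≤ p) (hq : 0 ≤ q)
    (hM : M ∈ p • signHull X Y) (hN : N ∈ q • signHull X Y) :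
    M + N ∈ (p + q) • signHull X Y := by
  rw [convex_signHull.add_smul hp hq]
  exact Set.add_mem_add hM hN

variable [Finite X] [Finite Y]

theorem mul_mem_signHull {a : X → ℝ} {b : Y → ℝ} (ha : ∀ x, |a x| ≤ 1) (hb : ∀ y, |b y| ≤ 1) :
    (fun x y => a x * b y) ∈ signHull X Y := by
  have h1 : ∀ s : X → ℝ, (∀ x, s x ∈ ({-1, 1} : Set ℝ)) →
      (fun x y => s x * b y) ∈ signHull X Y := by
    intro s hs
    let L : (Y → ℝ) →ₗ[ℝ] (X → Y → ℝ) :=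
      { toFun := fun t x y => s x * t y
        map_add' := fun _ _ => by ext; simp [mul_add]
        map_smul' := fun _ _ => by ext; simp; ring }
    have h2 := Set.mem_image_of_mem L (mem_convexHull_signs hb)
    rw [L.image_convexHull] at h2
    refine convexHull_mono ?_ h2
    rintro _ ⟨t, ht, rfl⟩
    exact ⟨s, hs, t, ht, rfl⟩
  let L : (X → ℝ) →ₗ[ℝ] (X → Y → ℝ) :=
    { toFun := fun s x y => s x * b y
      map_add' := fun _ _ => by ext; simp [add_mul]
      map_smul' := fun _ _ => by ext; simp; ring }
  have h2 := Set.mem_image_of_mem L (mem_convexHull_signs ha)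
  rw [L.image_convexHull] at h2
  refine convexHull_min ?_ (convex_convexHull ℝ _) h2
  rintro _ ⟨s, hs, rfl⟩
  exact h1 s hs

theorem zero_mem_signHull : (0 : X → Y → ℝ) ∈ signHull X Y := by
  have := mul_mem_signHull (X := X) (Y := Y) (a := 0) (b := 0) (by simp) (by simp)
  convert this using 1
  ext; simp

theorem mem_smul_signHull_mono {M : X → Y → ℝ} {p q : ℝ} (hp : 0 ≤ p) (hpq : p ≤ q)
    (hM : M ∈ p • signHull X Y) : M ∈ q • signHull X Y := by
  have h := add_mem_smul_signHull hp (sub_nonneg.2 hpq) hM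
    (Set.smul_mem_smul_set (zero_mem_signHull (X := X) (Y := Y)))
  simpa using h

theorem sum_mem_smul_signHull {ι : Type} (s : Finset ι) {M : ι → X → Y → ℝ} {p : ι → ℝ}
    (hp : ∀ i, 0 ≤ p i) (hM : ∀ i, M i ∈ p i • signHull X Y) :
    ∑ i ∈ s, M i ∈ (∑ i ∈ s, p i) • signHull X Y := by
  classical
  induction s using Finset.induction_on with
  | empty =>
    simpa using Set.smul_mem_smul_set (a := (0 : ℝ)) (zero_mem_signHull (X := X) (Y := Y))
  | insert i s hi ih =>
    rw [Finset.sum_insert hi, Finset.sum_insert hi]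
    exact add_mem_smul_signHull (hp i) (Finset.sum_nonneg fun j _ => hp j) (hM i) ih

theorem mul_mem_smul_signHull {a : X → ℝ} {b : Y → ℝ} {p q : ℝ} (hp : 0 < p) (hq : 0 < q)
    (ha : ∀ x, |a x| ≤ p) (hb : ∀ y, |b y| ≤ q) :
    (fun x y => a x * b y) ∈ (p * q) • signHull X Y := by
  refine ⟨fun x y => (a x / p) * (b y / q), mul_mem_signHull (fun x => ?_) (fun y => ?_), ?_⟩
  · rw [abs_div, abs_of_pos hp]; exact div_le_one_of_le₀ (ha x) hp.le
  · rw [abs_div, abs_of_pos hq]; exact div_le_one_of_le₀ (hb y) hq.le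
  · ext x y
    simp only [Pi.smul_apply, smul_eq_mul]
    field_simp

/-- The crude bound that starts the iteration: `M` is the sum of its single-entry parts, each a
rank-one matrix with entries in `[-1, 1]`. -/
theorem FactorsWithin.mem_card_smul_signHull [Fintype X] [Fintype Y] {M : X → Y → ℝ}
    (hM : FactorsWithin M 1) :
    M ∈ (Fintype.card (X × Y) : ℝ) • signHull X Y := by
  classical
  have h : M = ∑ p : X × Y, fun x y => (if x = p.1 then M p.1 p.2 else 0) *
      (if y = p.2 then 1 else 0) := by
    ext x y
    rw [Finset.sum_apply, Finset.sum_apply, Fintype.sum_prod_type]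
    simp
  have h1 : (Fintype.card (X × Y) : ℝ) = ∑ _p : X × Y, 1 * 1 := by simp
  rw [h1]
  conv => enter [2]; rw [h]
  refine sum_mem_smul_signHull _ (fun _ => by norm_num) fun p =>
    mul_mem_smul_signHull one_pos one_pos (fun x => ?_) (fun y => ?_)
  · split_ifs
    · exact hM.abs_le _ _
    · simp
  · split_ifs <;> simp

/-- Independent random signs: orthonormality and the fourth moment inequality. -/
theorem exists_randomSigns (k : ℕ) : ∃ (Ω : Type) (_ : Fintype Ω) (r : Fin k → Ω → ℝ),
    Nonempty Ω ∧
    (∀ u v : Fin k → ℝ, ∑ ω, (∑ i, u i * r i ω) * (∑ i, v i * r i ω) =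
      Fintype.card Ω * ∑ i, u i * v i) ∧
    ∀ u : Fin k → ℝ, ∑ ω, (∑ i, u i * r i ω) ^ 4 ≤ 3 * Fintype.card Ω * (∑ i, u i ^ 2) ^ 2 := by
  induction k with
  | zero => exact ⟨Unit, inferInstance, fun _ _ => 0, inferInstance, by simp, by simp⟩
  | succ k ih =>
    obtain ⟨Ω, _, r, _, h2, h4⟩ := ih
    -- The sample space is doubled and the new sign is `1` on one copy and `-1` on the other, so the
    -- terms with an odd power of it cancel.
    refine ⟨Ω ⊕ Ω, inferInstance,
      Fin.cons (Sum.elim (fun _ => 1) fun _ => -1) fun i => Sum.elim (r i) (r i),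
      inferInstance, fun u v => ?_, fun u => ?_⟩
    · have h := h2 (fun i => u i.succ) fun i => v i.succ
      simp only [Fintype.sum_sum_type, Fin.sum_univ_succ, Fin.cons_zero, Fin.cons_succ,
        Sum.elim_inl, Sum.elim_inr, Fintype.card_sum, Nat.cast_add]
      rw [← Finset.sum_add_distrib]
      trans ∑ ω, (2 * (u 0 * v 0) +
        2 * ((∑ i, u (Fin.succ i) * r i ω) * ∑ i, v (Fin.succ i) * r i ω))
      · exact Finset.sum_congr rfl fun ω _ => by ring
      · rw [Finset.sum_add_distrib, ← Finset.mul_sum, ← Finset.mul_sum, ← Finset.mul_sum, h]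
        simp only [Finset.sum_const, Finset.card_univ, nsmul_eq_mul]
        ring
    · have h := h2 (fun i => u i.succ) fun i => u i.succ
      have h' := h4 fun i => u i.succ
      simp only [Fintype.sum_sum_type, Fin.sum_univ_succ, Fin.cons_zero, Fin.cons_succ,
        Sum.elim_inl, Sum.elim_inr, Fintype.card_sum, Nat.cast_add]
      rw [← Finset.sum_add_distrib]
      have e : ∀ ω, (u 0 * 1 + ∑ i, u (Fin.succ i) * r i ω) ^ 4 +
          (u 0 * -1 + ∑ i, u (Fin.succ i) * r i ω) ^ 4 = 2 * u 0 ^ 4 +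
          12 * u 0 ^ 2 * ((∑ i, u (Fin.succ i) * r i ω) * ∑ i, u (Fin.succ i) * r i ω) +
          2 * (∑ i, u (Fin.succ i) * r i ω) ^ 4 := fun ω => by ring
      simp_rw [e]
      rw [Finset.sum_add_distrib, Finset.sum_add_distrib,
        ← Finset.mul_sum, ← Finset.mul_sum, ← Finset.mul_sum, h]
      simp only [Finset.sum_const, Finset.card_univ, nsmul_eq_mul, ← sq]
      have : 0 ≤ (Fintype.card Ω : ℝ) * u 0 ^ 4 := by positivity
      nlinarith

/-- The part of `s` that exceeds `t` in absolute value. -/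
noncomputable def tail (t s : ℝ) : ℝ := if |s| ≤ t then 0 else s

theorem abs_sub_tail_le {t : ℝ} (ht : 0 ≤ t) (s : ℝ) : |s - tail t s| ≤ t := by
  unfold tail; split_ifs with h <;> simp [h, ht]

theorem sub_tail_sq_le (t s : ℝ) : (s - tail t s) ^ 2 ≤ s ^ 2 := by
  unfold tail; split_ifs with h <;> simp [sq_nonneg]

theorem tail_sq_le {t : ℝ} (ht : 0 ≤ t) (s : ℝ) : t ^ 2 * tail t s ^ 2 ≤ s ^ 4 := by
  unfold tail; split_ifs with h
  · simp; positivity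
  · have : t ^ 2 ≤ s ^ 2 := by
      rw [← sq_abs s]; exact pow_le_pow_left₀ ht (not_le.1 h).le 2
    nlinarith [sq_nonneg s]

/-- One step of the iteration for Grothendieck's inequality: truncate the random variables that
represent the rows and the columns, and apply the inequality to the tails. -/
theorem signHull_improve {K : ℝ} (hK : 0 ≤ K)
    (h : ∀ M : X → Y → ℝ, FactorsWithin M 1 → M ∈ K • signHull X Y)
    {M : X → Y → ℝ} (hM : FactorsWithin M 1) : M ∈ (48 + K / 2) • signHull X Y := by
  obtain ⟨L, _, A, B, hAB, hA, hB⟩ := hM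
  obtain ⟨Ω, _, r, _, h2, h4⟩ := exists_randomSigns (Fintype.card L)
  let e := Fintype.equivFin L
  have hn : (0 : ℝ) < Fintype.card Ω := by exact_mod_cast Fintype.card_pos
  set n : ℝ := (Fintype.card Ω : ℝ)
  let S : X → Ω → ℝ := fun x ω => ∑ i, A x (e.symm i) * r i ω
  let R : Y → Ω → ℝ := fun y ω => ∑ i, B y (e.symm i) * r i ω
  have hSR : ∀ x y, M x y = ∑ ω, S x ω * R y ω / n := by
    intro x y
    rw [← Finset.sum_div, h2 (fun i => A x (e.symm i)) fun i => B y (e.symm i), hAB,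
      Equiv.sum_comp e.symm fun i => A x i * B y i]
    field_simp
  have key : ∀ u : L → ℝ, ∑ i, u i ^ 2 ≤ 1 →
      ∑ ω, (∑ i, u (e.symm i) * r i ω) ^ 2 ≤ n ∧
      ∑ ω, (∑ i, u (e.symm i) * r i ω) ^ 4 ≤ 3 * n := by
    intro u hu
    have hu' : ∑ i, u (e.symm i) ^ 2 ≤ 1 := by
      rwa [Equiv.sum_comp e.symm fun i => u i ^ 2]
    have h0 : 0 ≤ ∑ i, u (e.symm i) ^ 2 := Finset.sum_nonneg fun _ _ => sq_nonneg _
    constructor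
    · have := h2 (fun i => u (e.symm i)) fun i => u (e.symm i)
      simp only [← sq] at this
      rw [this]
      exact mul_le_of_le_one_right hn.le hu'
    · exact (h4 _).trans (mul_le_of_le_one_right (by positivity) (pow_le_one₀ h0 hu'))
  -- The mean square of a tail is at most the fourth moment over `t ^ 2`, that is `3 / 48 = 1 / 16`:
  -- tails have norm at most `1 / 4`.
  obtain ⟨t, ht0, ht⟩ : ∃ t : ℝ, 0 < t ∧ t ^ 2 = 48 := ⟨√48, by positivity, by norm_num⟩
  have htail : ∀ f : Ω → ℝ, ∑ ω, f ω ^ 4 ≤ 3 * n → ∑ ω, tail t (f ω) ^ 2 ≤ n / 16 := by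
    intro f hf
    have : 48 * ∑ ω, tail t (f ω) ^ 2 ≤ ∑ ω, f ω ^ 4 := by
      rw [Finset.mul_sum]
      exact Finset.sum_le_sum fun ω _ => ht ▸ tail_sq_le ht0.le (f ω)
    linarith
  have hS2 : ∀ x, ∑ ω, S x ω ^ 2 ≤ n := fun x => (key _ (hA x)).1
  have hR2 : ∀ y, ∑ ω, R y ω ^ 2 ≤ n := fun y => (key _ (hB y)).1
  have hSt : ∀ x, ∑ ω, tail t (S x ω) ^ 2 ≤ n / 16 := fun x => htail _ (key _ (hA x)).2
  have hRt : ∀ y, ∑ ω, tail t (R y ω) ^ 2 ≤ n / 16 := fun y => htail _ (key _ (hB y)).2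
  have hs : √n ^ 2 = n := Real.sq_sqrt hn.le
  have hs0 : √n ≠ 0 := by positivity
  -- The product `S * R` splits as bounded times bounded, bounded times tail, and tail times
  -- everything. The first is an explicit mixture of rank-one matrices with entries at most `t ^ 2 =
  -- 48`; the other two have small factorization norm, so the hypothesis on `K` applies to them.
  let M₁ : X → Y → ℝ := ∑ ω, fun x y => (S x ω - tail t (S x ω)) *
    ((R y ω - tail t (R y ω)) / n)
  let M₂ : X → Y → ℝ := fun x y => ∑ ω, (S x ω - tail t (S x ω)) / √n * (tail t (R y ω) / √n)
  let M₃ : X → Y → ℝ := fun x y => ∑ ω, tail t (S x ω) / √n * (R y ω / √n)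
  have hsum : M = M₁ + (M₂ + M₃) := by
    ext x y
    simp only [M₁, M₂, M₃, Pi.add_apply, Finset.sum_apply]
    rw [hSR, ← Finset.sum_add_distrib, ← Finset.sum_add_distrib]
    refine Finset.sum_congr rfl fun ω _ => ?_
    simp only [div_mul_div_comm, ← sq, hs]
    ring
  have hM₁ : M₁ ∈ (48 : ℝ) • signHull X Y := by
    have h48 : (48 : ℝ) = ∑ _ω : Ω, t * (t / n) := by
      simp only [Finset.sum_const, Finset.card_univ, nsmul_eq_mul]
      change 48 = n * _
      rw [← ht]; field_simp
    rw [h48]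
    refine sum_mem_smul_signHull _ (fun _ => by positivity) fun ω =>
      mul_mem_smul_signHull ht0 (by positivity) (fun x => abs_sub_tail_le ht0.le _) (fun y => ?_)
    rw [abs_div, abs_of_pos hn]
    exact div_le_div_of_nonneg_right (abs_sub_tail_le ht0.le _) hn.le
  have hquarter : ∀ N : X → Y → ℝ, FactorsWithin N (1 / 4) → N ∈ (K / 4) • signHull X Y := by
    intro N hN
    obtain ⟨N', hN', e⟩ := h (fun x y => 4 * N x y) ((hN.smul 4).congr (fun _ _ => rfl) (by norm_num))
    refine ⟨N', hN', ?_⟩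
    ext x y
    have := congrFun (congrFun e x) y
    simp only [Pi.smul_apply, smul_eq_mul] at this ⊢
    linarith
  have hM₂ : M₂ ∈ (K / 4) • signHull X Y := by
    -- Squared norms `1` and `1 / 16` are balanced to `1 / 4` each; for `M₃` the roles are
    -- exchanged, hence the scaling by `2` there.
    refine hquarter _ (FactorsWithin.of_mul_le (a := 1 / 2) (by norm_num) (fun x y => rfl)
      (fun x => ?_) fun y => ?_)
    · simp only [div_pow, hs, ← Finset.sum_div]
      have : ∑ ω, (S x ω - tail t (S x ω)) ^ 2 ≤ n :=
        (Finset.sum_le_sum fun ω _ => sub_tail_sq_le t (S x ω)).trans (hS2 x)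
      have := div_le_one_of_le₀ this hn.le
      linarith
    · simp only [div_pow, hs, ← Finset.sum_div]
      rw [div_le_iff₀ hn]
      linarith [hRt y]
  have hM₃ : M₃ ∈ (K / 4) • signHull X Y := by
    refine hquarter _ (FactorsWithin.of_mul_le (a := 2) (by norm_num) (fun x y => rfl)
      (fun x => ?_) fun y => ?_)
    · simp only [div_pow, hs, ← Finset.sum_div]
      have := (div_le_iff₀ hn).2 ((hSt x).trans_eq (by ring : n / 16 = 1 / 16 * n))
      linarith
    · simp only [div_pow, hs, ← Finset.sum_div]
      rw [div_le_iff₀ hn]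
      linarith [hR2 y]
  have := add_mem_smul_signHull (by norm_num) (by positivity) hM₁
    (add_mem_smul_signHull (by positivity) (by positivity) hM₂ hM₃)
  rw [hsum]
  convert this using 2
  ring

/-- Grothendieck's inequality, with the constant `100`. -/
theorem FactorsWithin.mem_smul_signHull {M : X → Y → ℝ} (hM : FactorsWithin M 1) :
    M ∈ (100 : ℝ) • signHull X Y := by
  have := Fintype.ofFinite X
  have := Fintype.ofFinite Y
  set c : ℝ := (Fintype.card (X × Y) : ℝ)
  have hc : 0 ≤ c := Nat.cast_nonneg _
  -- `96` is the fixed point of `K ↦ 48 + K / 2`, and the excess over it halves at each step.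
  have h : ∀ j : ℕ, ∀ N : X → Y → ℝ, FactorsWithin N 1 →
      N ∈ (96 + c / 2 ^ j) • signHull X Y := by
    intro j
    induction j with
    | zero =>
      intro N hN
      exact mem_smul_signHull_mono hc (by simp) hN.mem_card_smul_signHull
    | succ j ih =>
      intro N hN
      convert signHull_improve (by positivity) ih hN using 2
      ring
  obtain ⟨j, hj⟩ := pow_unbounded_of_one_lt (c / 4) (one_lt_two (α := ℝ))
  refine mem_smul_signHull_mono (by positivity) ?_ (h j M hM)
  have : c / 2 ^ j ≤ 4 := by rw [div_le_iff₀ (by positivity)]; linarith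
  linarith

end Grothendieck

/-! ### Classical protocols from one-way communication -/

section Classical

variable {X Y : Type}

/-- Alice sends `t` bits that depend on her input, then Bob announces the output. -/
def DetProtocol.oneWay : (t : ℕ) → (X → Fin t → Bool) → (Y → (Fin t → Bool) → Bool) →
    DetProtocol X Y
  | 0, _, β => .bob (fun y => β y Fin.elim0) .leaf
  | t + 1, α, β => .alice (fun x => α x 0) fun m =>
      oneWay t (fun x => Fin.tail (α x)) fun y v => β y (Fin.cons m v)

theorem DetProtocol.eval_oneWay (t : ℕ) (α : X → Fin t → Bool) (β : Y → (Fin t → Bool) → Bool)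
    (x : X) (y : Y) : (oneWay t α β).eval x y = β y (α x) := by
  induction t with
  | zero => simp only [oneWay, eval]; congr; ext i; exact i.elim0
  | succ t ih => simp [oneWay, eval, ih, Fin.cons_self_tail]

theorem DetProtocol.cost_oneWay (t : ℕ) (α : X → Fin t → Bool) (β : Y → (Fin t → Bool) → Bool) :
    (oneWay t α β).cost = t + 1 := by
  induction t with
  | zero => simp [oneWay, cost]
  | succ t ih => simp [oneWay, cost, ih]

theorem exists_publicCoinProtocol {ι : Type} [Fintype ι] {w : ι → ℝ} (hw : ∀ i, 0 ≤ w i)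
    (hw1 : ∑ i, w i = 1) (T : ι → DetProtocol X Y) {c : ℕ} (hc : ∀ i, (T i).cost ≤ c) :
    ∃ p : PublicCoinProtocol X Y, p.cost ≤ c ∧
      ∀ x y, p.acceptProb x y = ∑ i, if (T i).eval x y = true then w i else 0 := by
  let e := Fintype.equivFin ι
  refine ⟨⟨Fintype.card ι, fun i => w (e.symm i), And.intro (fun i => hw _) ?_, fun i => T (e.symm i)⟩,
    Finset.sup_le fun i _ => hc _, fun x y => ?_⟩
  · rw [Equiv.sum_comp e.symm w, hw1]
  · exact Equiv.sum_comp e.symm fun i => if (T i).eval x y = true then w i else 0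

theorem exactRpub_le {ε : ℝ} {f : X → Y → Bool} {p : PublicCoinProtocol X Y} {c : ℕ}
    (hp : HasExactError ε f p.acceptProb) (hc : p.cost ≤ c) : exactRpub ε f ≤ c := by
  have h : p.cost ∈ publicCoinCosts ε f := ⟨p, hp, rfl⟩
  exact (Nat.sInf_le h).trans hc

theorem publicCoinCosts_nonempty [Finite X] {ε : ℝ} (h0 : 0 ≤ ε) (h1 : ε ≤ 1)
    (f : X → Y → Bool) : (publicCoinCosts ε f).Nonempty := by
  classical
  have := Fintype.ofFinite X
  -- Alice sends her whole input in one-hot encoding; the public coin `s` flips the correct answer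
  -- with probability `ε`.
  let α : X → Fin (Fintype.card X) → Bool := fun x i => decide (Fintype.equivFin X x = i)
  have hα : Function.Injective α := fun x x' h => by
    simpa [α, eq_comm] using congrFun h (Fintype.equivFin X x)
  let T : Bool → DetProtocol X Y := fun s => .oneWay _ α fun y v =>
    xor s (decide (∃ x, α x = v ∧ f x y = true))
  obtain ⟨p, -, hp⟩ := exists_publicCoinProtocol (w := fun s => if s then ε else 1 - ε)
    (by simp [h0, h1]) (by simp) T (fun s => (DetProtocol.cost_oneWay _ _ _).le)
  refine ⟨_, p, fun x y => ?_, rfl⟩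
  rw [hp]
  have : (∃ x', α x' = α x ∧ f x' y = true) ↔ f x y = true :=
    ⟨fun ⟨x', h, h'⟩ => hα h ▸ h', fun h => ⟨x, rfl, h⟩⟩
  simp only [T, DetProtocol.eval_oneWay, this]
  cases f x y <;> simp

/-- This covers the degenerate cases where there is no positive lower bound on the factorization
norm: the zero Boolean matrix and empty input sets. -/
theorem exactRpub_eq_zero_of_const {ε : ℝ} (h0 : 0 ≤ ε) (h1 : ε ≤ 1) {f : X → Y → Bool}
    (hf : ∀ x y, f x y = false) : exactRpub ε f = 0 := by
  obtain ⟨p, hc, hp⟩ := exists_publicCoinProtocol (w := fun s => if s then ε else 1 - ε)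
    (by simp [h0, h1]) (by simp) (fun s => (.leaf s : DetProtocol X Y)) (c := 0)
    (fun s => le_rfl)
  refine Nat.le_zero.1 (exactRpub_le (p := p) (fun x y => ?_) hc)
  simp [hp, DetProtocol.eval, hf]

/-! ### Amplification by majority vote -/

/-- The majority of the votes is `true`. -/
def majority {t : ℕ} (z : Fin t → Bool) : Bool :=
  decide (0 < ∑ j, if z j = true then (1 : ℤ) else -1)

/-- A sum of an odd number of signs is odd, so there are no ties. -/
theorem majority_not {t : ℕ} (ht : Odd t) (z : Fin t → Bool) :
    majority (fun j => !z j) = !majority z := by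
  have h1 : ∑ j, (if (!z j) = true then (1 : ℤ) else -1) =
      -∑ j, if z j = true then (1 : ℤ) else -1 := by
    rw [← Finset.sum_neg_distrib]
    exact Finset.sum_congr rfl fun j _ => by cases z j <;> simp
  have h2 : (∑ j, if z j = true then (1 : ℤ) else -1) ≠ 0 := by
    intro h0
    have : ((∑ j, if z j = true then (1 : ℤ) else -1 : ℤ) : ZMod 2) = t := by
      push_cast
      rw [Finset.sum_congr rfl (g := fun _ => (1 : ZMod 2))
        (fun j _ => by cases z j <;> simp)]
      simp
    rw [h0, (ZMod.natCast_eq_one_iff_odd).2 ht] at this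
    simp at this
  unfold majority
  rw [h1]
  by_cases h : 0 < ∑ j, if z j = true then (1 : ℤ) else -1
  · simp only [h, decide_true, Bool.not_true, decide_eq_false_iff_not]; omega
  · simp only [h, decide_false, Bool.not_false, decide_eq_true_eq]; omega

/-- The probability that the majority of `t` independent votes is `true`, when each vote is `v`
with probability `w v`. -/
noncomputable def majorityProb (t : ℕ) (w : Bool → ℝ) : ℝ :=
  ∑ z : Fin t → Bool, if majority z = true then ∏ j, w (z j) else 0

theorem sum_prod_votes (t : ℕ) (w : Bool → ℝ) :
    ∑ z : Fin t → Bool, ∏ j, w (z j) = (w true + w false) ^ t := by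
  classical
  have := Finset.prod_univ_sum (fun _ : Fin t => (Finset.univ : Finset Bool)) fun _ b => w b
  simp only [Fintype.piFinset_univ, Fintype.sum_bool, Finset.prod_const, Finset.card_univ,
    Fintype.card_fin] at this
  exact this.symm

theorem majorityProb_not {t : ℕ} (ht : Odd t) (w : Bool → ℝ) :
    majorityProb t w + majorityProb t (fun b => w (!b)) = (w true + w false) ^ t := by
  have h : majorityProb t (fun b => w (!b)) =
      ∑ z : Fin t → Bool, if majority z = true then 0 else ∏ j, w (z j) := by
    unfold majorityProb
    rw [← Equiv.sum_comp (Equiv.piCongrRight fun _ : Fin t => Equiv.boolNot)]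
    refine Finset.sum_congr rfl fun z _ => ?_
    have : majority ((Equiv.piCongrRight fun _ : Fin t => Equiv.boolNot) z) = !majority z :=
      majority_not ht z
    rw [this]
    cases majority z <;> simp
  rw [h, majorityProb, ← Finset.sum_add_distrib, ← sum_prod_votes]
  refine Finset.sum_congr rfl fun z _ => ?_
  cases majority z <;> simp

theorem zpow_sum_eq_prod {ι : Type} {a : ℝ} (ha : a ≠ 0) (s : Finset ι) (n : ι → ℤ) :
    a ^ (∑ j ∈ s, n j) = ∏ j ∈ s, a ^ n j := by
  classical
  induction s using Finset.induction_on with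
  | empty => simp
  | insert i s hi ih => rw [Finset.sum_insert hi, Finset.prod_insert hi, zpow_add₀ ha, ih]

theorem one_le_prod_of_majority {t : ℕ} {d : ℝ} (hd : 0 < d) (hd1 : d < 1) {z : Fin t → Bool}
    (hz : majority z = true) : 1 ≤ ∏ j, if z j = true then (1 - d)⁻¹ else 1 - d := by
  have h : ∏ j, (if z j = true then (1 - d)⁻¹ else 1 - d) =
      ((1 - d)⁻¹) ^ (∑ j, if z j = true then (1 : ℤ) else -1) := by
    rw [zpow_sum_eq_prod (inv_ne_zero (by linarith))]
    exact Finset.prod_congr rfl fun j _ => by split_ifs <;> simp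
  rw [h]
  refine one_le_zpow₀ (one_le_inv₀ (by linarith) |>.2 (by linarith)) ?_
  exact (of_decide_eq_true hz).le

theorem majorityProb_nonneg (t : ℕ) {w : Bool → ℝ} (hw : ∀ b, 0 ≤ w b) : 0 ≤ majorityProb t w :=
  Finset.sum_nonneg fun z _ => by
    split_ifs
    · exact Finset.prod_nonneg fun j _ => hw _
    · exact le_rfl

/-- A Chernoff bound: weight `(1 - d)⁻¹` for a `true` vote and `1 - d` for a `false` one has product
at least `1` on every majority, and the mean weight of one vote is `1 - d ^ 2 / 2`. -/
theorem majorityProb_le {d : ℝ} (hd : 0 < d) (hd1 : d < 1) (t : ℕ) :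
    majorityProb t (fun b => if b = true then (1 - d) / 2 else (1 + d) / 2) ≤
      (1 - d ^ 2 / 2) ^ t := by
  have h1 : (1 - d ^ 2 / 2) =
      (fun b => (if b = true then (1 - d)⁻¹ else 1 - d) *
        (if b = true then (1 - d) / 2 else (1 + d) / 2)) true +
      (fun b => (if b = true then (1 - d)⁻¹ else 1 - d) *
        (if b = true then (1 - d) / 2 else (1 + d) / 2)) false := by
    have : 1 - d ≠ 0 := by linarith
    simp only [if_true, Bool.false_eq_true, if_false]
    field_simp
    ring
  rw [h1, ← sum_prod_votes t fun b => (if b = true then (1 - d)⁻¹ else 1 - d) *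
    (if b = true then (1 - d) / 2 else (1 + d) / 2)]
  refine Finset.sum_le_sum fun z _ => ?_
  have h0 : 0 ≤ ∏ j, (if z j = true then (1 - d) / 2 else (1 + d) / 2) :=
    Finset.prod_nonneg fun j _ => by split_ifs <;> linarith
  rw [Finset.prod_mul_distrib]
  split_ifs with hz
  · exact le_mul_of_one_le_left h0 (one_le_prod_of_majority hd hd1 hz)
  · refine mul_nonneg (Finset.prod_nonneg fun j _ => ?_) h0
    split_ifs
    · exact inv_nonneg.2 (by linarith)
    · linarith

theorem majorityProb_le_of_le {d ε : ℝ} (hd : 0 < d) (hd1 : d < 1) (hε : 0 < ε) {t : ℕ}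
    (ht : 2 / (ε * d ^ 2) ≤ t) :
    majorityProb t (fun b => if b = true then (1 - d) / 2 else (1 + d) / 2) ≤ ε := by
  refine (majorityProb_le hd hd1 t).trans ?_
  -- Bernoulli's inequality, combined with `(1 - s) * (1 + s) ≤ 1` for `s = d ^ 2 / 2`, replaces
  -- exponentials and logarithms.
  have h1 : 1 + t * (d ^ 2 / 2) ≤ (1 + d ^ 2 / 2) ^ t :=
    one_add_mul_le_pow (by nlinarith [sq_nonneg d]) t
  have h2 : (1 - d ^ 2 / 2) ^ t * (1 + d ^ 2 / 2) ^ t ≤ 1 := by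
    rw [← mul_pow]
    have : d ^ 2 ≤ 1 := pow_le_one₀ hd.le hd1.le
    exact pow_le_one₀ (mul_nonneg (by linarith) (by positivity)) (by nlinarith)
  have h3 : 1 / ε ≤ t * (d ^ 2 / 2) := by
    rw [div_le_iff₀ (by positivity)] at ht
    rw [div_le_iff₀ hε]
    nlinarith
  have h4 : 0 ≤ (1 - d ^ 2 / 2) ^ t := pow_nonneg (by nlinarith) t
  have h5 : (1 - d ^ 2 / 2) ^ t * (1 / ε) ≤ 1 :=
    (mul_le_mul_of_nonneg_left (by linarith) h4).trans h2
  rwa [mul_one_div, div_le_one hε] at h5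

/-- Independent repetitions of a random experiment with a Boolean result. -/
theorem sum_majority_eq {ι : Type} [Fintype ι] (t : ℕ) (p : ι → ℝ) (v : ι → Bool) :
    (∑ i : Fin t → ι, if majority (fun j => v (i j)) = true then ∏ j, p (i j) else 0) =
      majorityProb t fun b => ∑ i, if v i = b then p i else 0 := by
  classical
  unfold majorityProb
  -- The samples are grouped by their vote pattern; on each pattern the sum of products is a product
  -- of sums.
  rw [← Finset.sum_fiberwise (s := Finset.univ) (g := fun (i : Fin t → ι) j => v (i j))]
  refine Finset.sum_congr rfl fun z _ => ?_
  have h := Finset.prod_univ_sum (fun j : Fin t => Finset.univ.filter fun i => v i = z j)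
    fun _ i => p i
  have h2 : (∏ j, ∑ i, if v i = z j then p i else 0) =
      ∑ i : Fin t → ι with (fun j => v (i j)) = z, ∏ j, p (i j) := by
    simp_rw [← Finset.sum_filter]
    rw [h]
    refine Finset.sum_congr ?_ fun _ _ => rfl
    ext i
    simp [funext_iff]
  rw [h2]
  split_ifs with hz
  · refine Finset.sum_congr rfl fun i hi => ?_
    rw [(Finset.mem_filter.1 hi).2, if_pos hz]
  · refine Finset.sum_eq_zero fun i hi => ?_
    rw [(Finset.mem_filter.1 hi).2, if_neg hz]

/-- A sign matrix with small factorization norm has a protocol with exact error and few bits. -/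
theorem exactRpub_le_of_factorsWithin [Finite X] [Finite Y] {ε : ℝ} (hε₀ : 0 < ε)
    (hε₁ : ε < 1 / 2) {f : X → Y → Bool} {c : ℝ} (hc : 1 ≤ c)
    (hf : FactorsWithin (commMatrix 1 (-1) f) c) {t : ℕ} (ht : Odd t)
    (hct : 20000 * c ^ 2 / ε ≤ t) : exactRpub ε f ≤ t + 1 := by
  classical
  obtain ⟨N, hN, e⟩ := ((hf.smul c⁻¹).congr (fun _ _ => rfl) (by
    rw [abs_of_pos (by positivity), inv_mul_cancel₀ (by positivity)])).mem_smul_signHull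
  obtain ⟨ι, _, p, z, hp0, hp1, hz, hzN⟩ := mem_convexHull_iff_exists_fintype.1 hN
  choose a ha b hb hab using hz
  set d : ℝ := 1 / (100 * c)
  have hd : 0 < d := by positivity
  have hd1 : d < 1 := by rw [div_lt_one (by positivity)]; linarith
  -- The correlation is exactly `d` on every input, not merely at least `d`; exact error rests on
  -- this.
  have hE : ∀ x y, ∑ i, p i * (a i x * b i y) = d * if f x y = true then -1 else 1 := by
    intro x y
    have h1 := congrFun (congrFun e x) y
    have h2 := congrFun (congrFun hzN x) y
    simp only [Finset.sum_apply, Pi.smul_apply, smul_eq_mul, commMatrix, Matrix.of_apply, hab]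
      at h1 h2
    rw [h2]
    field_simp at h1
    simp only [d]
    field_simp
    linarith
  let v : ι → X → Y → Bool := fun i x y => xor (decide (a i x = 1)) (decide (b i y = 1))
  have hv : ∀ i x y, a i x * b i y = if v i x y = true then -1 else 1 := by
    intro i x y
    have h1 : (-1 : ℝ) ≠ 1 := by norm_num
    rcases ha i x with h | h <;> rcases hb i y with h' | h' <;>
      simp_all [v]
  have hw : ∀ x y s, (∑ i, if v i x y = s then p i else 0) =
      if s = f x y then (1 + d) / 2 else (1 - d) / 2 := by
    intro x y s
    have h1 : ∑ i, p i * (a i x * b i y) = 1 - 2 * ∑ i, if v i x y = true then p i else 0 := by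
      rw [← hp1, Finset.mul_sum, ← Finset.sum_sub_distrib]
      refine Finset.sum_congr rfl fun i _ => ?_
      rw [hv]
      split_ifs <;> ring
    have h2 : (∑ i, if v i x y = false then p i else 0) +
        (∑ i, if v i x y = true then p i else 0) = 1 := by
      rw [← hp1, ← Finset.sum_add_distrib]
      refine Finset.sum_congr rfl fun i _ => ?_
      cases v i x y <;> simp
    rw [hE] at h1
    cases s <;> cases hfx : f x y <;> simp only [hfx] at h1 ⊢ <;> simp at h1 ⊢ <;> linarith
  set q := majorityProb t fun b => if b = true then (1 - d) / 2 else (1 + d) / 2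
  have hq0 : 0 ≤ q := majorityProb_nonneg t fun b => by split_ifs <;> linarith
  have hqε : q ≤ ε := by
    refine majorityProb_le_of_le hd hd1 hε₀ (le_trans (le_of_eq ?_) hct)
    simp only [d]
    field_simp
    norm_num
  have hq' : majorityProb t (fun b => if b = true then (1 + d) / 2 else (1 - d) / 2) = 1 - q := by
    have h := majorityProb_not ht fun b => if b = true then (1 - d) / 2 else (1 + d) / 2
    have h1 : (fun b : Bool => if (!b) = true then (1 - d) / 2 else (1 + d) / 2) =
        fun b => if b = true then (1 + d) / 2 else (1 - d) / 2 := by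
      ext b; cases b <;> simp
    rw [h1] at h
    have h2 : (1 - d) / 2 + (1 + d) / 2 = 1 := by ring
    simp only [if_true, Bool.false_eq_true, if_false, h2, one_pow] at h
    linarith
  have hmaj : ∀ x y, (∑ i : Fin t → ι,
      if majority (fun j => v (i j) x y) = true then ∏ j, p (i j) else 0) =
      if f x y = true then 1 - q else q := by
    intro x y
    rw [sum_majority_eq t p fun i => v i x y]
    simp_rw [hw]
    cases f x y
    · simp only [Bool.false_eq_true, if_false, q]
      congr 1; ext b; cases b <;> simp
    · simp only [if_true, ← hq']
  -- Flipping the majority answer with probability `r` raises the error from `q` to exactly `ε`.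
  obtain ⟨r, hr0, hr1, hr⟩ : ∃ r : ℝ, 0 ≤ r ∧ r ≤ 1 ∧ (1 - r) * q + r * (1 - q) = ε := by
    have h2 : 0 < 1 - 2 * q := by linarith
    refine ⟨(ε - q) / (1 - 2 * q), div_nonneg (by linarith) h2.le, ?_, ?_⟩
    · rw [div_le_one h2]; linarith
    · linear_combination div_mul_cancel₀ (ε - q) h2.ne'
  have htot : ∑ i : Fin t → ι, ∏ j, p (i j) = 1 := by
    have := Finset.prod_univ_sum (fun _ : Fin t => (Finset.univ : Finset ι)) fun _ i => p i
    simpa [hp1] using this.symm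
  -- Alice sends her sign for each of the `t` samples; Bob compares them with his own, takes the
  -- majority and applies the flip `k.2`.
  let T : (Fin t → ι) × Bool → DetProtocol X Y := fun k =>
    .oneWay t (fun x j => decide (a (k.1 j) x = 1)) fun y m =>
      xor k.2 (majority fun j => xor (m j) (decide (b (k.1 j) y = 1)))
  obtain ⟨P, hPc, hP⟩ := exists_publicCoinProtocol
    (w := fun k : (Fin t → ι) × Bool => (∏ j, p (k.1 j)) * if k.2 = true then r else 1 - r)
    (fun k => mul_nonneg (Finset.prod_nonneg fun j _ => hp0 _) (by split_ifs <;> linarith))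
    (by
      rw [Fintype.sum_prod_type]
      simp only [Fintype.sum_bool, if_true, Bool.false_eq_true, if_false, ← mul_add,
        add_sub_cancel, mul_one, htot])
    T (fun k => (DetProtocol.cost_oneWay _ _ _).le)
  refine exactRpub_le (p := P) (fun x y => ?_) hPc
  rw [hP, Fintype.sum_prod_type]
  have h1 : ∀ i : Fin t → ι, (∑ s : Bool, if (T (i, s)).eval x y = true then
      (∏ j, p (i j)) * (if s = true then r else 1 - r) else 0) =
      r * (∏ j, p (i j)) + (1 - 2 * r) *
        if majority (fun j => v (i j) x y) = true then ∏ j, p (i j) else 0 := by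
    intro i
    simp only [T, DetProtocol.eval_oneWay, Fintype.sum_bool]
    change (if (xor true (majority fun j => v (i j) x y)) = true then _ else _) +
      (if (xor false (majority fun j => v (i j) x y)) = true then _ else _) = _
    cases majority (fun j => v (i j) x y) <;> simp <;> ring
  refine (Finset.sum_congr rfl fun i _ => h1 i).trans ?_
  rw [Finset.sum_add_distrib, ← Finset.mul_sum, ← Finset.mul_sum, htot, hmaj]
  split_ifs <;> linarith

theorem exactRpub_eq_zero_of_isEmpty {ε : ℝ} (h : ¬∃ (_ : X) (_ : Y), True)
    (h0 : 0 ≤ ε) (h1 : ε ≤ 1) (f : X → Y → Bool) : exactRpub ε f = 0 :=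
  exactRpub_eq_zero_of_const h0 h1 fun x y => (h ⟨x, y, trivial⟩).elim

theorem exactRpub_le_sign [Finite X] [Finite Y] {ε : ℝ} (hε₀ : 0 < ε) (hε₁ : ε < 1 / 2)
    (f : X → Y → Bool) :
    (exactRpub ε f : ℝ) ≤ (160000 / ε + 4) * gammaTwo (commMatrix 1 (-1) f) ^ 2 := by
  by_cases h : ∃ (_ : X) (_ : Y), True
  · obtain ⟨x, y, -⟩ := h
    set g := gammaTwo (commMatrix 1 (-1) f)
    have hg : 1 ≤ g := by
      have : |commMatrix 1 (-1) f x y| = 1 := by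
        simp only [commMatrix, Matrix.of_apply]; split_ifs <;> simp
      exact this ▸ abs_le_gammaTwo _ x y
    -- Since `g ≥ 1`, doubling supplies the strict inequality. The number of votes is `2 * m + 1`,
    -- to be odd.
    have hf : FactorsWithin (commMatrix 1 (-1) f) (2 * g) :=
      factorsWithin_of_gammaTwo_lt (by linarith)
    set m := ⌈40000 * g ^ 2 / ε⌉₊
    have hm : 40000 * g ^ 2 / ε ≤ m := Nat.le_ceil _
    have hm' : (m : ℝ) < 40000 * g ^ 2 / ε + 1 := Nat.ceil_lt_add_one (by positivity)
    have hR := exactRpub_le_of_factorsWithin hε₀ hε₁ (by linarith) hf (odd_two_mul_add_one m) (by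
      push_cast
      have : 20000 * (2 * g) ^ 2 / ε = 2 * (40000 * g ^ 2 / ε) := by ring
      linarith)
    have hR' : (exactRpub ε f : ℝ) ≤ 2 * m + 1 + 1 := by exact_mod_cast hR
    have e : (160000 / ε + 4) * g ^ 2 = 4 * (40000 * g ^ 2 / ε) + 4 * g ^ 2 := by ring
    have : 0 ≤ 40000 * g ^ 2 / ε := by positivity
    rw [e]
    nlinarith
  · rw [exactRpub_eq_zero_of_isEmpty h hε₀.le (by linarith)]
    rw [Nat.cast_zero]
    positivity

/-! ### Affine changes of the matrix: from sign to Boolean -/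

theorem FactorsWithin.affine {M N : X → Y → ℝ} {c : ℝ} (hM : FactorsWithin M c) (a b : ℝ)
    (h : ∀ x y, N x y = a * M x y + b) : FactorsWithin N (|a| * c + |b|) :=
  ((hM.smul a).add (factorsWithin_const_one.smul b)).congr (fun x y => by rw [h, mul_one])
    (by rw [mul_one])

theorem gammaTwo_affine_le [Finite X] [Finite Y] {M N : Matrix X Y ℝ} (a b : ℝ)
    (h : ∀ x y, N x y = a * M x y + b) : gammaTwo N ≤ |a| * gammaTwo M + |b| := by
  refine le_of_forall_pos_le_add fun η hη => ?_
  have hη' : 0 < η / (|a| + 1) := by positivity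
  have := gammaTwo_nonneg M
  -- The slack is divided by `|a| + 1` rather than `|a|` so that `a = 0` is allowed.
  refine ((factorsWithin_of_gammaTwo_lt (lt_add_of_pos_right _ hη')).affine a b h
    |>.gammaTwo_le (by positivity)).trans ?_
  have : |a| * (η / (|a| + 1)) ≤ η := by
    rw [mul_div_assoc', div_le_iff₀ (by positivity)]
    nlinarith [abs_nonneg a]
  linarith

theorem gammaTwo_sign_le [Finite X] [Finite Y] (f : X → Y → Bool) :
    gammaTwo (commMatrix 1 (-1) f) ≤ 2 * gammaTwo (commMatrix 0 1 f) + 1 := by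
  refine (gammaTwo_affine_le (M := commMatrix 0 1 f) (-2) 1 fun x y => ?_).trans_eq (by norm_num)
  simp only [commMatrix, Matrix.of_apply]
  split_ifs <;> norm_num

/-- A 1-input forces `γ₂ ≥ 1`, so `2 * γ₂ + 1 ≤ 3 * γ₂`, whence the factor `9`; without 1-inputs no
communication is needed. -/
theorem exactRpub_le_boolean [Finite X] [Finite Y] {ε : ℝ} (hε₀ : 0 < ε) (hε₁ : ε < 1 / 2)
    (f : X → Y → Bool) :
    (exactRpub ε f : ℝ) ≤ 9 * (160000 / ε + 4) * gammaTwo (commMatrix 0 1 f) ^ 2 := by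
  by_cases h : ∃ x y, f x y = true
  · obtain ⟨x, y, hxy⟩ := h
    have h1 : 1 ≤ gammaTwo (commMatrix 0 1 f) := by
      simpa [commMatrix, hxy] using abs_le_gammaTwo (commMatrix 0 1 f) x y
    have h2 := gammaTwo_sign_le f
    have h3 := gammaTwo_nonneg (commMatrix 1 (-1) f)
    have h4 : gammaTwo (commMatrix 1 (-1) f) ^ 2 ≤ 9 * gammaTwo (commMatrix 0 1 f) ^ 2 := by
      nlinarith
    refine (exactRpub_le_sign hε₀ hε₁ f).trans ?_
    calc _ ≤ (160000 / ε + 4) * (9 * gammaTwo (commMatrix 0 1 f) ^ 2) := by gcongr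
      _ = _ := by ring
  · rw [exactRpub_eq_zero_of_const hε₀.le (by linarith) fun x y => by
      simpa using fun hxy => h ⟨x, y, hxy⟩]
    rw [Nat.cast_zero]
    positivity

end Classical

/-! ### The factorization norm of the acceptance probabilities of quantum protocols -/

section Quantum

open Matrix ComplexConjugate

variable {X Y : Type}

namespace QuantumProtocol

/-- The protocol with the roles of the players exchanged. -/
def swap : {A B : Type} → QuantumProtocol X Y A B → QuantumProtocol Y X B A
  | _, _, aliceSends U h next => bobSends U h next.swap
  | _, _, bobSends V h next => aliceSends V h next.swap
  | _, _, aliceOutputs U h => bobOutputs U h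
  | _, _, bobOutputs V h => aliceOutputs V h

theorem cost_swap {A B : Type} (q : QuantumProtocol X Y A B) : q.swap.cost = q.cost := by
  induction q with
  | aliceSends U h next ih => simp [swap, cost, ih]
  | bobSends U h next ih => simp [swap, cost, ih]
  | aliceOutputs => rfl
  | bobOutputs => rfl

theorem acceptProb_swap {A B : Type} (q : QuantumProtocol X Y A B) (x : X) (y : Y) :
    ∀ [Fintype A] [Fintype B] (ψ : A → B → ℂ),
      q.swap.acceptProb y x (fun b a => ψ a b) = q.acceptProb x y ψ := by
  induction q with
  | aliceSends U h next ih => intro _ _ ψ; simp only [swap, acceptProb, ← ih]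
  | bobSends U h next ih => intro _ _ ψ; simp only [swap, acceptProb, ← ih]
  | aliceOutputs => intro _ _ ψ; simp only [swap, acceptProb]; exact Finset.sum_comm
  | bobOutputs => intro _ _ ψ; simp only [swap, acceptProb]; exact Finset.sum_comm

end QuantumProtocol

/-- The squared Euclidean norm of a complex vector. -/
noncomputable def normSqSum {A : Type} [Fintype A] (v : A → ℂ) : ℝ := ∑ a, ‖v a‖ ^ 2

section NormSq

variable {A B : Type} [Fintype A] [Fintype B]

theorem normSqSum_nonneg (v : A → ℂ) : 0 ≤ normSqSum v :=
  Finset.sum_nonneg fun _ _ => sq_nonneg _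

theorem ofReal_normSqSum (v : A → ℂ) : (normSqSum v : ℂ) = star v ⬝ᵥ v := by
  simp only [normSqSum, dotProduct, Pi.star_apply, RCLike.star_def, Complex.conj_mul']
  push_cast
  rfl

theorem normSqSum_sub (u v : A → ℂ) :
    normSqSum (u - v) = normSqSum u - 2 * (star u ⬝ᵥ v).re + normSqSum v := by
  simp only [normSqSum, dotProduct, Complex.re_sum, Finset.mul_sum, Pi.sub_apply, Pi.star_apply]
  rw [← Finset.sum_sub_distrib, ← Finset.sum_add_distrib]
  refine Finset.sum_congr rfl fun a _ => ?_
  simp only [← Complex.normSq_eq_norm_sq, Complex.normSq_apply, RCLike.star_def, Complex.mul_re,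
    Complex.conj_re, Complex.conj_im, Complex.sub_re, Complex.sub_im]
  ring

theorem IsIsometryMatrix.normSqSum_mulVec {U : Matrix A B ℂ} (hU : IsIsometryMatrix U)
    (v : B → ℂ) : normSqSum (U *ᵥ v) = normSqSum v := by
  classical
  have hU' : Uᴴ * U = 1 := by
    unfold IsIsometryMatrix at hU; convert hU
  rw [← Complex.ofReal_inj, ofReal_normSqSum, ofReal_normSqSum, star_mulVec, dotProduct_mulVec,
    vecMul_vecMul, hU', vecMul_one]

/-- The adjoint of a contraction is a contraction: expand the squared norm of `u - M Mᴴ u`, which is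
nonnegative. -/
theorem normSqSum_conjTranspose_mulVec_le {M : Matrix A B ℂ}
    (hM : ∀ v, normSqSum (M *ᵥ v) ≤ normSqSum v) (u : A → ℂ) :
    normSqSum (Mᴴ *ᵥ u) ≤ normSqSum u := by
  have h : (star u ⬝ᵥ (M *ᵥ (Mᴴ *ᵥ u))) = normSqSum (Mᴴ *ᵥ u) := by
    rw [ofReal_normSqSum, star_mulVec, conjTranspose_conjTranspose, dotProduct_mulVec]
  have h1 := normSqSum_nonneg (u - M *ᵥ (Mᴴ *ᵥ u))
  rw [normSqSum_sub, h, Complex.ofReal_re] at h1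
  linarith [hM (Mᴴ *ᵥ u)]

/-- The block of a matrix that belongs to the value `m` of the message qubit. -/
def msgBlock (U : Matrix (A × Bool) B ℂ) (m : Bool) : Matrix A B ℂ :=
  Matrix.of fun a b => U (a, m) b

theorem IsIsometryMatrix.sum_normSqSum_msgBlock {U : Matrix (A × Bool) B ℂ}
    (hU : IsIsometryMatrix U) (v : B → ℂ) :
    ∑ m, normSqSum (msgBlock U m *ᵥ v) = normSqSum v := by
  rw [← hU.normSqSum_mulVec v]
  simp only [normSqSum, Fintype.sum_prod_type]
  exact Finset.sum_comm

theorem IsIsometryMatrix.normSqSum_msgBlock_le {U : Matrix (A × Bool) B ℂ}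
    (hU : IsIsometryMatrix U) (m : Bool) (v : B → ℂ) :
    normSqSum (msgBlock U m *ᵥ v) ≤ normSqSum v := by
  rw [← hU.sum_normSqSum_msgBlock v]
  exact Finset.single_le_sum (f := fun m => normSqSum (msgBlock U m *ᵥ v))
    (fun m _ => normSqSum_nonneg _) (Finset.mem_univ m)

theorem trace_conjTranspose_mul (M N : Matrix A B ℂ) :
    (Mᴴ * N).trace = ∑ a, ∑ b, conj (M a b) * N a b := by
  rw [Finset.sum_comm]
  rfl

end NormSq

/-- The quadratic form `ψ ↦ P x y ψ` on the states of two registers is a sum of tensor products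
whose factors have squared row norms, and squared column norms, at most `c`. -/
def HasTensorDecomposition {A B : Type} [Fintype A] [Fintype B]
    (P : X → Y → Matrix A B ℂ → ℝ) (c : ℝ) : Prop :=
  ∃ (K : Type) (_ : Fintype K) (F : X → K → Matrix A A ℂ) (G : Y → K → Matrix B B ℂ),
    (∀ x v, ∑ k, normSqSum (F x k *ᵥ v) ≤ c * normSqSum v) ∧
    (∀ y w, ∑ k, normSqSum (w ᵥ* G y k) ≤ c * normSqSum w) ∧
    ∀ x y ψ, (P x y ψ : ℂ) = ∑ k, ((F x k * ψ)ᴴ * (ψ * G y k)).trace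

section Decomposition

variable {A B A' : Type} [Fintype A] [Fintype B] [Fintype A']

theorem HasTensorDecomposition.swap {P : X → Y → Matrix A B ℂ → ℝ} {c : ℝ}
    (h : HasTensorDecomposition P c) :
    HasTensorDecomposition (fun y x (ψ : Matrix B A ℂ) => P x y ψᵀ) c := by
  obtain ⟨K, _, F, G, hF, hG, hP⟩ := h
  refine ⟨K, inferInstance, fun y k => (G y k)ᵀ, fun x k => (F x k)ᵀ,
    fun y w => ?_, fun x v => ?_, fun y x ψ => ?_⟩
  · simpa only [mulVec_transpose] using hG y w
  · simpa only [vecMul_transpose] using hF x v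
  -- The value is real, hence equal to its conjugate, and conjugation exchanges the two sides of the
  -- inner product.
  · rw [← Complex.conj_ofReal, hP, map_sum]
    refine Finset.sum_congr rfl fun k _ => ?_
    rw [trace_conjTranspose_mul, trace_conjTranspose_mul, Finset.sum_comm, map_sum]
    refine Finset.sum_congr rfl fun b _ => ?_
    rw [map_sum]
    refine Finset.sum_congr rfl fun a _ => ?_
    have h1 : (ψ * (F x k)ᵀ) b a = (F x k * ψᵀ) a b := by
      rw [← transpose_apply (F x k * ψᵀ), transpose_mul, transpose_transpose]
    have h2 : ((G y k)ᵀ * ψ) b a = (ψᵀ * G y k) a b := by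
      rw [← transpose_apply (ψᵀ * G y k), transpose_mul, transpose_transpose]
    rw [h1, h2, map_mul, Complex.conj_conj, mul_comm]

theorem hasTensorDecomposition_output {U : X → Matrix (A' × Bool) A ℂ}
    (hU : ∀ x, IsIsometryMatrix (U x)) :
    HasTensorDecomposition (fun x (_ : Y) (ψ : Matrix A B ℂ) =>
      ∑ a', ∑ b, ‖∑ a, U x (a', true) a * ψ a b‖ ^ 2) 1 := by
  classical
  refine ⟨Unit, inferInstance, fun x _ => (msgBlock (U x) true)ᴴ * msgBlock (U x) true,
    fun _ _ => 1, fun x v => ?_, fun y w => ?_, fun x y ψ => ?_⟩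
  · simp only [Finset.univ_unique, Finset.sum_singleton, one_mul, ← mulVec_mulVec]
    exact (normSqSum_conjTranspose_mulVec_le ((hU x).normSqSum_msgBlock_le true) _).trans
      ((hU x).normSqSum_msgBlock_le true v)
  · simp
  · simp only [Finset.univ_unique, Finset.sum_singleton, Matrix.mul_one]
    have : (((msgBlock (U x) true)ᴴ * msgBlock (U x) true * ψ)ᴴ * ψ).trace =
        ((msgBlock (U x) true * ψ)ᴴ * (msgBlock (U x) true * ψ)).trace := by
      simp only [conjTranspose_mul, conjTranspose_conjTranspose, Matrix.mul_assoc]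
    rw [this, trace_conjTranspose_mul]
    push_cast
    refine Finset.sum_congr rfl fun a' _ => Finset.sum_congr rfl fun b _ => ?_
    rw [Complex.conj_mul']
    rfl

/-- One message of Alice doubles the cost of a tensor decomposition. -/
theorem HasTensorDecomposition.message {U : X → Matrix (A' × Bool) A ℂ}
    (hU : ∀ x, IsIsometryMatrix (U x)) {P : X → Y → Matrix A' (B × Bool) ℂ → ℝ} {c : ℝ}
    (h : HasTensorDecomposition P c) :
    HasTensorDecomposition (fun x y (ψ : Matrix A B ℂ) =>
      P x y (Matrix.of fun a' bm => ∑ a, U x (a', bm.2) a * ψ a bm.1)) (2 * c) := by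
  obtain ⟨K, _, F, G, hF, hG, hP⟩ := h
  -- The new state is the sum over `m` of `msgBlock (U x) m * ψ` tensored with the basis state `m`
  -- of Bob's new qubit. Hence the quadratic form splits into the blocks of `G` in that qubit, and
  -- the blocks of `U x` pass to Alice's operator. On her side the sum over `m` is absorbed by the
  -- isometry and only the sum over `m'` costs a factor `2`.
  refine ⟨K × Bool × Bool, inferInstance,
    fun x k => (msgBlock (U x) k.2.2)ᴴ * F x k.1 * msgBlock (U x) k.2.1,
    fun y k => Matrix.of fun b b' => G y k.1 (b, k.2.2) (b', k.2.1),
    fun x v => ?_, fun y w => ?_, fun x y ψ => ?_⟩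
  · simp only [Fintype.sum_prod_type, ← mulVec_mulVec]
    calc _ ≤ ∑ k, ∑ m, ∑ _m' : Bool, normSqSum (F x k *ᵥ (msgBlock (U x) m *ᵥ v)) := by
          refine Finset.sum_le_sum fun k _ => Finset.sum_le_sum fun m _ =>
            Finset.sum_le_sum fun m' _ => ?_
          exact normSqSum_conjTranspose_mulVec_le ((hU x).normSqSum_msgBlock_le m') _
      _ = 2 * ∑ m, ∑ k, normSqSum (F x k *ᵥ (msgBlock (U x) m *ᵥ v)) := by
          rw [Finset.sum_comm]
          simp only [Finset.sum_const, Finset.card_univ, Fintype.card_bool, nsmul_eq_mul,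
            Finset.mul_sum, Nat.cast_ofNat]
      _ ≤ 2 * ∑ m, c * normSqSum (msgBlock (U x) m *ᵥ v) := by
          gcongr with m
          exact hF x _
      _ = _ := by rw [← Finset.mul_sum, (hU x).sum_normSqSum_msgBlock, mul_assoc]
  -- Summing over the blocks of `G` in row `m'` amounts to applying `G` to `w` tensored with the
  -- basis state `m'`; the two values of `m'` give the factor `2`.
  · let e : Bool → B × Bool → ℂ := fun m' p => if p.2 = m' then w p.1 else 0
    have he : ∀ m', normSqSum (e m') = normSqSum w := fun m' => by
      simp only [normSqSum, Fintype.sum_prod_type, e]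
      refine Finset.sum_congr rfl fun b _ => ?_
      cases m' <;> simp
    calc _ = ∑ m', ∑ k, normSqSum (e m' ᵥ* G y k) := by
          rw [Finset.sum_comm, Fintype.sum_prod_type]
          refine Finset.sum_congr rfl fun k _ => ?_
          rw [Fintype.sum_prod_type, Finset.sum_comm]
          refine Finset.sum_congr rfl fun m' _ => ?_
          simp only [normSqSum, Fintype.sum_prod_type (α₁ := B)]
          rw [Finset.sum_comm]
          refine Finset.sum_congr rfl fun b _ => Finset.sum_congr rfl fun m _ => ?_
          congr 2
          simp only [vecMul, dotProduct, Fintype.sum_prod_type, e, Matrix.of_apply]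
          refine Finset.sum_congr rfl fun b' _ => ?_
          cases m' <;> simp
      _ ≤ ∑ m', c * normSqSum (e m') := Finset.sum_le_sum fun m' _ => hG y (e m')
      _ = _ := by simp only [he]; simp [mul_assoc]
  · rw [hP, Fintype.sum_prod_type]
    refine Finset.sum_congr rfl fun k _ => ?_
    rw [Fintype.sum_prod_type]
    set φ : Matrix A' (B × Bool) ℂ := Matrix.of fun a' bm => ∑ a, U x (a', bm.2) a * ψ a bm.1
    have h1 : ∀ a' b m, (F x k * φ) a' (b, m) = (F x k * (msgBlock (U x) m * ψ)) a' b :=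
      fun _ _ _ => rfl
    have h2 : ∀ a' b m, (φ * G y k) a' (b, m) = ∑ m',
        (msgBlock (U x) m' * ψ * Matrix.of fun b b' => G y k (b, m') (b', m)) a' b := by
      intro a' b m
      simp only [Matrix.mul_apply, Fintype.sum_prod_type]
      rw [Finset.sum_comm]
      rfl
    have h3 : ∀ (m m' : Bool) (H : Matrix B B ℂ),
        (((msgBlock (U x) m')ᴴ * F x k * msgBlock (U x) m * ψ)ᴴ * (ψ * H)).trace =
        ((F x k * (msgBlock (U x) m * ψ))ᴴ * (msgBlock (U x) m' * ψ * H)).trace := by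
      intro m m' H
      simp only [conjTranspose_mul, conjTranspose_conjTranspose, Matrix.mul_assoc]
    simp only [h3]
    simp only [trace_conjTranspose_mul, Fintype.sum_prod_type, h1, h2, Fintype.sum_bool, mul_add,
      Finset.sum_add_distrib]

theorem QuantumProtocol.hasTensorDecomposition {A B : Type} (q : QuantumProtocol X Y A B) :
    ∀ [Fintype A] [Fintype B], HasTensorDecomposition
      (fun x y (ψ : Matrix A B ℂ) => q.acceptProb x y ψ) (2 ^ q.cost) := by
  induction q with
  | aliceSends U h next ih =>
    intro _ _
    rw [cost, pow_succ']
    exact (ih.message h)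
  | bobSends U h next ih =>
    intro _ _
    rw [cost, pow_succ']
    have := (ih.swap.message h).swap
    exact this
  | aliceOutputs U h => intro _ _; exact hasTensorDecomposition_output h
  | bobOutputs V h =>
    intro _ _
    rw [cost, pow_zero]
    convert (hasTensorDecomposition_output (Y := X) h).swap using 1
    funext x y ψ
    exact Finset.sum_comm

/-- The vectors are the entries of all `F x k * ψ` and of all `ψ * G y k`, with real and imaginary
parts as separate coordinates. The bounds are applied to each column, respectively row, of `ψ` and
add up to `c` by normalization. -/
theorem HasTensorDecomposition.factorsWithin {P : X → Y → Matrix A B ℂ → ℝ} {c : ℝ}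
    (h : HasTensorDecomposition P c) {ψ : Matrix A B ℂ}
    (hψ : ∑ a, ∑ b, ‖ψ a b‖ ^ 2 = 1) : FactorsWithin (fun x y => P x y ψ) c := by
  obtain ⟨K, _, F, G, hF, hG, hP⟩ := h
  have hre : ∀ z : ℂ, ‖z‖ ^ 2 = z.re ^ 2 + z.im ^ 2 := fun z => by
    rw [← Complex.normSq_eq_norm_sq, Complex.normSq_apply]; ring
  refine ⟨K × A × B × Bool, inferInstance,
    fun x i => if i.2.2.2 = true then ((F x i.1 * ψ) i.2.1 i.2.2.1).re
      else ((F x i.1 * ψ) i.2.1 i.2.2.1).im,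
    fun y i => if i.2.2.2 = true then ((ψ * G y i.1) i.2.1 i.2.2.1).re
      else ((ψ * G y i.1) i.2.1 i.2.2.1).im, fun x y => ?_, fun x => ?_, fun y => ?_⟩
  · change P x y ψ = _
    rw [← Complex.ofReal_re (P x y ψ), hP]
    simp only [trace_conjTranspose_mul, Complex.re_sum, Fintype.sum_prod_type, Fintype.sum_bool,
      Complex.mul_re, Complex.conj_re, Complex.conj_im, if_true, Bool.false_eq_true, if_false]
    simp only [neg_mul, sub_neg_eq_add]
  · simp only [Fintype.sum_prod_type, Fintype.sum_bool, if_true, Bool.false_eq_true, if_false,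
      ← hre]
    calc _ = ∑ b, ∑ k, normSqSum (F x k *ᵥ fun a => ψ a b) := by
          exact (Finset.sum_congr rfl fun k _ => Finset.sum_comm).trans Finset.sum_comm
      _ ≤ ∑ b, c * normSqSum (fun a => ψ a b) := Finset.sum_le_sum fun b _ => hF x _
      _ = c := by
          rw [← Finset.mul_sum]
          simp only [normSqSum]
          rw [Finset.sum_comm, hψ, mul_one]
  · simp only [Fintype.sum_prod_type, Fintype.sum_bool, if_true, Bool.false_eq_true, if_false,
      ← hre]
    calc _ = ∑ a, ∑ k, normSqSum (ψ a ᵥ* G y k) := Finset.sum_comm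
      _ ≤ ∑ a, c * normSqSum (ψ a) := Finset.sum_le_sum fun a _ => hG y _
      _ = c := by
          rw [← Finset.mul_sum]
          simp only [normSqSum]
          rw [hψ, mul_one]

end Decomposition

theorem EntangledProtocol.gammaTwo_acceptProb_le [Finite X] [Finite Y]
    (p : EntangledProtocol X Y) : gammaTwo (Matrix.of p.acceptProb) ≤ 2 ^ p.cost := by
  let _ := p.fintypeA
  let _ := p.fintypeB
  have h := p.interaction.hasTensorDecomposition.factorsWithin p.norm_eq_one
  exact FactorsWithin.gammaTwo_le (by positivity) h

end Quantum

/-! ### Quantum simulation of classical protocols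

The order of the messages of a quantum protocol is fixed, while the speaker at a node of a protocol
tree may depend on the coins and on the preceding bits. In the simulation the players alternate,
and each qubit carries two classical bits by superdense coding. -/

namespace DetProtocol

variable {X Y : Type}

/-- The protocol with the roles of the players exchanged. -/
def swap : DetProtocol X Y → DetProtocol Y X
  | leaf out => leaf out
  | alice bit next => bob bit fun b => (next b).swap
  | bob bit next => alice bit fun b => (next b).swap

theorem eval_swap (T : DetProtocol X Y) (x : X) (y : Y) : T.swap.eval y x = T.eval x y := by
  induction T with
  | leaf => rfl
  | alice bit next ih => exact ih _
  | bob bit next ih => exact ih _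

theorem cost_swap (T : DetProtocol X Y) : T.swap.cost = T.cost := by
  induction T with
  | leaf => rfl
  | alice bit next ih => simp [swap, cost, ih]
  | bob bit next ih => simp [swap, cost, ih]

/-- The bit that Alice sends at the root, if she speaks there. -/
def aliceBit : DetProtocol X Y → X → Bool
  | alice bit _, x => bit x
  | _, _ => false

/-- The remaining protocol after Alice, if she speaks at the root, has sent `m`. -/
def afterAlice : DetProtocol X Y → Bool → DetProtocol X Y
  | alice _ next, m => next m
  | T, _ => T

theorem eval_afterAlice (T : DetProtocol X Y) (x : X) (y : Y) :
    (T.afterAlice (T.aliceBit x)).eval x y = T.eval x y := by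
  cases T <;> rfl

/-- The next two bits of Alice. -/
def aliceBits (T : DetProtocol X Y) (x : X) : Bool × Bool :=
  (T.aliceBit x, (T.afterAlice (T.aliceBit x)).aliceBit x)

/-- The remaining protocol after two bits of Alice. -/
def afterAliceBits (T : DetProtocol X Y) (m : Bool × Bool) : DetProtocol X Y :=
  (T.afterAlice m.1).afterAlice m.2

theorem eval_afterAliceBits (T : DetProtocol X Y) (x : X) (y : Y) :
    (T.afterAliceBits (T.aliceBits x)).eval x y = T.eval x y :=
  (eval_afterAlice _ x y).trans (eval_afterAlice T x y)

/-- The output at a leaf. -/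
def leafOut : DetProtocol X Y → Bool
  | leaf out => out
  | _ => false

theorem eval_of_cost_eq_zero {T : DetProtocol X Y} (hT : T.cost = 0) (x : X) (y : Y) :
    T.eval x y = T.leafOut := by
  cases T with
  | leaf => rfl
  | alice => simp [cost] at hT
  | bob => simp [cost] at hT

/-- `n` alternating messages of two bits, the first one by Alice, followed by an output of the
player whose turn it is, are enough for this protocol. -/
def Fits (n : ℕ) (T : DetProtocol X Y) : Prop :=
  T.cost ≤ n ∨ T.cost ≤ n + 1 ∧ ∃ bit next, T = alice bit next

theorem cost_next_le (bit : X → Bool) (next : Bool → DetProtocol X Y) (m : Bool) :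
    (next m).cost + 1 ≤ (alice bit next).cost := by
  cases m <;> simp [cost]

/-- If Bob is to speak, Alice's message is a dummy, but his being at the root is the allowance for
one extra bit after the swap. If Alice speaks, either both her bits make progress, or the first does
and Bob is next, which again earns the allowance. -/
theorem Fits.afterAliceBits {n : ℕ} {T : DetProtocol X Y} (hT : T.Fits (n + 1))
    (m : Bool × Bool) : (T.afterAliceBits m).swap.Fits n := by
  cases T with
  | leaf => exact .inl (Nat.zero_le _)
  | bob bit next =>
    rcases hT with h | ⟨-, _, _, h⟩
    · exact .inr ⟨(cost_swap _).trans_le h, _, _, rfl⟩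
    · exact nomatch h
  | alice bit next =>
    have h : (alice bit next).cost ≤ n + 2 := by
      rcases hT with h | ⟨h, -⟩ <;> omega
    have h1 := cost_next_le bit next m.1
    change ((next m.1).afterAlice m.2).swap.Fits n
    generalize next m.1 = T at h1
    cases T with
    | leaf => exact .inl (Nat.zero_le _)
    | bob bit' next' =>
      refine .inr ⟨(cost_swap _).trans_le ?_, _, _, rfl⟩
      change cost (bob bit' next') ≤ _
      omega
    | alice bit' next' =>
      have h2 := cost_next_le bit' next' m.2
      exact .inl ((cost_swap _).trans_le (by change cost (next' m.2) ≤ _; omega))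

/-- A last bit of Alice need not be sent, since she announces the output herself. -/
theorem Fits.eval_eq {T : DetProtocol X Y} (hT : T.Fits 0) (x : X) (y : Y) :
    T.eval x y = (T.afterAlice (T.aliceBit x)).leafOut := by
  rw [← eval_afterAlice]
  apply eval_of_cost_eq_zero
  cases T with
  | leaf => rfl
  | bob bit next =>
    rcases hT with h | ⟨-, _, _, h⟩
    · exact Nat.le_zero.1 h
    · exact nomatch h
  | alice bit next =>
    have h := cost_next_le bit next (bit x)
    have h' : (alice bit next).cost ≤ 1 := by rcases hT with h | ⟨h, -⟩ <;> omega
    change (next (bit x)).cost = 0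
    omega

end DetProtocol

/-! ### Local isometries and superdense coding -/

section Isometry

open Classical Matrix

theorem isIsometryMatrix_iff {A B : Type} [Fintype A] (U : Matrix A B ℂ) :
    IsIsometryMatrix U ↔ ∀ b b', ∑ a, star (U a b) * U a b' = if b = b' then 1 else 0 := by
  unfold IsIsometryMatrix
  rw [← Matrix.ext_iff]
  rfl

theorem IsIsometryMatrix.mul {A B C : Type} [Fintype A] [Fintype B] {U : Matrix A B ℂ}
    {W : Matrix B C ℂ} (hU : IsIsometryMatrix U) (hW : IsIsometryMatrix W) :
    IsIsometryMatrix (U * W) := by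
  unfold IsIsometryMatrix at *
  rw [conjTranspose_mul, Matrix.mul_assoc, ← Matrix.mul_assoc Uᴴ, hU, Matrix.one_mul, hW]

theorem IsIsometryMatrix.tensor_one {B B' : Type} [Fintype B'] {W : Matrix B' B ℂ}
    (hW : IsIsometryMatrix W) : IsIsometryMatrix
      (Matrix.of fun (p : B' × Bool) (q : B × Bool) => if p.2 = q.2 then W p.1 q.1 else 0) := by
  rw [isIsometryMatrix_iff] at hW ⊢
  rintro ⟨b, m⟩ ⟨b', m'⟩
  have := hW b b'
  rw [Fintype.sum_prod_type_right]
  simp only [Matrix.of_apply, Fintype.sum_bool]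
  cases m <;> cases m' <;> simp [← this]

/-- Bob may apply an isometry to his register before the protocol starts. -/
theorem QuantumProtocol.exists_precompose {X Y A B' : Type} (q : QuantumProtocol X Y A B') :
    ∀ {B : Type} [Fintype B'] (W : Matrix B' B ℂ), IsIsometryMatrix W →
      ∃ q' : QuantumProtocol X Y A B, q'.cost = q.cost ∧
        ∀ x y [Fintype A] [Fintype B] (ψ : A → B → ℂ),
          q'.acceptProb x y ψ = q.acceptProb x y fun a b' => ∑ b, W b' b * ψ a b := by
  induction q with
  | aliceSends U h next ih =>
    intro B _ W hW
    -- Bob's isometry commutes with Alice's step, so it is postponed, acting trivially on the qubit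
    -- he receives, until Bob acts and absorbs it.
    obtain ⟨q', hc, hq⟩ := ih _ hW.tensor_one
    refine ⟨aliceSends U h q', by rw [cost, cost, hc], fun x y _ _ ψ => ?_⟩
    rw [acceptProb, acceptProb, hq]
    congr 1
    funext a' bm
    rw [Fintype.sum_prod_type]
    simp only [Matrix.of_apply, ite_mul, zero_mul, Finset.sum_ite_eq, Finset.mem_univ, if_true]
    simp only [Finset.mul_sum]
    rw [Finset.sum_comm]
    exact Finset.sum_congr rfl fun a _ => Finset.sum_congr rfl fun b _ => by ring
  | bobSends V h next ih =>
    intro B _ W hW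
    refine ⟨bobSends (fun y => V y * W) (fun y => (h y).mul hW) next, rfl, fun x y _ _ ψ => ?_⟩
    rw [acceptProb, acceptProb]
    congr 1
    funext am b'
    simp only [Matrix.mul_apply, Finset.sum_mul, Finset.mul_sum]
    rw [Finset.sum_comm]
    exact Finset.sum_congr rfl fun a _ => Finset.sum_congr rfl fun b _ => by ring
  | aliceOutputs U h =>
    intro B _ W hW
    refine ⟨aliceOutputs U h, rfl, fun x y _ _ ψ => ?_⟩
    rw [acceptProb, acceptProb]
    refine Finset.sum_congr rfl fun a' _ => ?_
    -- An isometry on Bob's side does not affect the statistics of Alice's measurement.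
    refine (hW.normSqSum_mulVec _).symm.trans ?_
    refine Finset.sum_congr rfl fun b _ => ?_
    congr 2
    simp only [mulVec, dotProduct, Finset.mul_sum]
    rw [Finset.sum_comm]
    exact Finset.sum_congr rfl fun a _ => Finset.sum_congr rfl fun b _ => by ring
  | bobOutputs V h =>
    intro B _ W hW
    refine ⟨bobOutputs (fun y => V y * W) (fun y => (h y).mul hW), rfl, fun x y _ _ ψ => ?_⟩
    rw [acceptProb, acceptProb]
    refine Finset.sum_congr rfl fun a _ => Finset.sum_congr rfl fun b' _ => ?_
    congr 2
    simp only [Matrix.mul_apply, Finset.sum_mul, Finset.mul_sum]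
    rw [Finset.sum_comm]
    exact Finset.sum_congr rfl fun a _ => Finset.sum_congr rfl fun b _ => by ring

/-- The entries of the Pauli matrices `Xᵃ Zᵇ`, for `m = (a, b)`. -/
noncomputable def pauli (m : Bool × Bool) (i j : Bool) : ℂ :=
  if i = xor j m.1 then if (m.2 && j) = true then -1 else 1 else 0

variable {H E : Type}

/-- The first step of superdense coding: apply the Pauli matrix for the message `μ h` to the half of
an EPR pair and send it, keeping a record of the message. -/
noncomputable def denseEncode (μ : H → Bool × Bool) :
    Matrix (((H × Bool × Bool) × E) × Bool) (H × Bool × E) ℂ :=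
  Matrix.of fun c a => if c.1.1.1 = a.1 then if c.1.1.2 = μ a.1 then if c.1.2 = a.2.2 then
    pauli c.1.1.2 c.2 a.2.1 else 0 else 0 else 0

/-- The second step of superdense coding: the receiver measures both halves in the Bell basis. -/
noncomputable def denseDecode : Matrix ((H × Bool × Bool) × E) ((H × Bool × E) × Bool) ℂ :=
  Matrix.of fun c b => if c.1.1 = b.1.1 then if c.2 = b.1.2.2 then
    pauli c.1.2 b.2 b.1.2.1 / (√2 : ℝ) else 0 else 0

variable [Fintype H] [Fintype E]

theorem sum_mul_denseEncode (μ : H → Bool × Bool) (f : ((H × Bool × Bool) × E) × Bool → ℂ)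
    (h : H) (i : Bool) (e : E) : ∑ c, f c * denseEncode μ c (h, i, e) =
      ∑ b, f (((h, μ h), e), b) * pauli (μ h) b i := by
  simp only [denseEncode, Matrix.of_apply, mul_ite, mul_zero]
  rw [Fintype.sum_prod_type_right]
  refine Finset.sum_congr rfl fun b _ => ?_
  rw [Fintype.sum_prod_type_right, Finset.sum_comm, Fintype.sum_prod_type]
  simp

theorem sum_mul_denseDecode (f : (H × Bool × Bool) × E → ℂ) (h : H) (i : Bool) (e : E) (b : Bool) :
    ∑ c, f c * denseDecode c ((h, i, e), b) =
      ∑ m, f ((h, m), e) * (pauli m b i / (√2 : ℝ)) := by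
  simp only [denseDecode, Matrix.of_apply, mul_ite, mul_zero]
  rw [Fintype.sum_prod_type_right, Finset.sum_comm, Fintype.sum_prod_type_right]
  simp

theorem isIsometryMatrix_denseEncode (μ : H → Bool × Bool) :
    IsIsometryMatrix (denseEncode (E := E) μ) := by
  rw [isIsometryMatrix_iff]
  rintro ⟨h, i, e⟩ ⟨h', i', e'⟩
  rw [sum_mul_denseEncode]
  simp only [denseEncode, Matrix.of_apply]
  by_cases hh : h = h'
  · subst hh
    by_cases he : e = e'
    · subst he
      rcases μ h with ⟨m₁, m₂⟩
      cases m₁ <;> cases m₂ <;> cases i <;> cases i' <;> simp [pauli]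
    · simp [he, Ne.symm he]
  · simp [hh, Ne.symm hh]

theorem sqrt_two_mul_sqrt_two : ((√2 : ℝ) : ℂ) * (√2 : ℝ) = 2 := by
  rw [← Complex.ofReal_mul, Real.mul_self_sqrt (by norm_num)]
  norm_num

theorem isIsometryMatrix_denseDecode : IsIsometryMatrix (denseDecode (H := H) (E := E)) := by
  rw [isIsometryMatrix_iff]
  rintro ⟨⟨h, i, e⟩, b⟩ ⟨⟨h', i', e'⟩, b'⟩
  rw [sum_mul_denseDecode]
  simp only [denseDecode, Matrix.of_apply]
  by_cases hh : h = h'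
  · subst hh
    by_cases he : e = e'
    · subst he
      have h2 : ((√2 : ℝ) : ℂ)⁻¹ * ((√2 : ℝ) : ℂ)⁻¹ = 1 / 2 := by
        rw [← mul_inv, sqrt_two_mul_sqrt_two, one_div]
      cases b <;> cases b' <;> cases i <;> cases i' <;>
        simp [pauli, Fintype.sum_prod_type, div_eq_mul_inv, h2] <;> norm_num
    · simp [he, Ne.symm he]
  · simp [hh, Ne.symm hh]

/-- The state with amplitude `p a` at `(a, a)`. -/
noncomputable def diagState {A : Type} (p : A → ℂ) (a b : A) : ℂ := if a = b then p a else 0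

theorem sum_mul_diagState {A : Type} [Fintype A] (p : A → ℂ) (f : A → ℂ) (b : A) :
    ∑ a, f a * diagState p a b = f b * p b := by
  simp [diagState]

theorem diagState_comm {A : Type} (p : A → ℂ) (a b : A) : diagState p a b = diagState p b a := by
  unfold diagState
  by_cases h : a = b
  · simp [h]
  · simp [h, Ne.symm h]

theorem sum_denseDecode_mul (f : (H × Bool × E) × Bool → ℂ) (h : H) (m : Bool × Bool) (e : E) :
    ∑ c, denseDecode ((h, m), e) c * f c =
      ∑ b, ∑ i, pauli m b i / (√2 : ℝ) * f ((h, i, e), b) := by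
  simp only [denseDecode, Matrix.of_apply, ite_mul, zero_mul]
  rw [Fintype.sum_prod_type_right]
  refine Finset.sum_congr rfl fun b _ => ?_
  rw [Fintype.sum_prod_type_right, Fintype.sum_prod_type]
  simp

/-- The state stays diagonal, with the message appended to the common record. The consumed EPR pair
is unnormalized, of squared norm `2`, which reappears as the factor `√2` in the amplitude. -/
theorem denseDecode_denseEncode (μ : H → Bool × Bool) (p : H → ℂ)
    (a b : (H × Bool × Bool) × E) :
    ∑ c, denseDecode b c * ∑ d, denseEncode μ (a, c.2) d * diagState (fun d => p d.1) d c.1 =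
      diagState (fun c => if c.1.2 = μ c.1.1 then (√2 : ℝ) * p c.1.1 else 0) a b := by
  obtain ⟨⟨h, m⟩, e⟩ := a
  obtain ⟨⟨h', m'⟩, e'⟩ := b
  have hs : ((√2 : ℝ) : ℂ) ≠ 0 := by
    rw [Complex.ofReal_ne_zero]; positivity
  have h2 : ((√2 : ℝ) : ℂ) ^ 2 = 2 := by rw [sq, sqrt_two_mul_sqrt_two]
  simp_rw [sum_mul_diagState]
  rw [sum_denseDecode_mul]
  simp only [denseEncode, Matrix.of_apply, diagState]
  by_cases hh : h = h'
  · subst hh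
    by_cases he : e = e'
    · subst he
      by_cases hm : m = μ h
      · simp only [if_true, ← hm]
        rcases m with ⟨m₁, m₂⟩
        rcases m' with ⟨m₁', m₂'⟩
        cases m₁ <;> cases m₂ <;> cases m₁' <;> cases m₂' <;> simp [pauli] <;> field_simp <;>
          simp [h2] <;> ring
      · simp [hm]
    · simp [he]
  · simp [hh]

/-- The amplitudes on the diagonal determine the acceptance probability of the simulation: both
players hold a copy of `h` and one half of a maximally entangled state on the index set `E`. -/
theorem DetProtocol.exists_quantumProtocol (n : ℕ) : ∀ {X Y H : Type} [Fintype H]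
    (T : H → DetProtocol X Y), (∀ h, (T h).Fits n) →
    ∃ (E : Type) (_ : Fintype E) (_ : Nonempty E) (q : QuantumProtocol X Y (H × E) (H × E)),
      q.cost = n ∧ ∀ x y (p : H → ℂ), q.acceptProb x y (diagState fun a => p a.1) =
        Fintype.card E * ∑ h, if (T h).eval x y = true then ‖p h‖ ^ 2 else 0 := by
  induction n with
  | zero =>
    intro X Y H _ T hT
    let out : X → H → Bool := fun x h => ((T h).afterAlice ((T h).aliceBit x)).leafOut
    let U : X → Matrix ((H × Unit) × Bool) (H × Unit) ℂ := fun x =>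
      Matrix.of fun c a => if c = (a, out x a.1) then 1 else 0
    have hU : ∀ x, IsIsometryMatrix (U x) := by
      intro x
      rw [isIsometryMatrix_iff]
      intro b b'
      simp only [U, Matrix.of_apply, mul_ite, mul_one, mul_zero, Finset.sum_ite_eq',
        Finset.mem_univ, if_true]
      by_cases hb : b = b'
      · simp [hb]
      · simp [hb, Ne.symm hb]
    refine ⟨Unit, inferInstance, inferInstance, .aliceOutputs U hU, rfl, fun x y p => ?_⟩
    rw [QuantumProtocol.acceptProb]
    simp_rw [sum_mul_diagState]
    rw [Finset.sum_comm, Fintype.sum_prod_type, Fintype.card_unit, Nat.cast_one, one_mul]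
    refine Finset.sum_congr rfl fun h _ => ?_
    rw [Fintype.sum_unique, (hT h).eval_eq]
    change (∑ a, ‖(if (a, true) = ((h, ()), out x h) then 1 else 0) * p h‖ ^ 2) =
      if out x h = true then _ else _
    cases out x h
    · simp
    · rw [Finset.sum_eq_single (h, ()) (fun a _ ha => by simp [ha]) (by simp)]
      simp
  | succ n ih =>
    intro X Y H _ T hT
    -- The record of the remaining protocol ranges over all messages, including those that Alice
    -- would not send on `x`; these get amplitude `0`.
    obtain ⟨E, _, _, q, hc, hq⟩ := ih (X := Y) (Y := X) (H := H × Bool × Bool)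
      (fun k => ((T k.1).afterAliceBits k.2).swap) fun k => (hT k.1).afterAliceBits k.2
    obtain ⟨q', hc', hq'⟩ := q.swap.exists_precompose denseDecode isIsometryMatrix_denseDecode
    refine ⟨Bool × E, inferInstance, inferInstance,
      .aliceSends (fun x => denseEncode fun h => (T h).aliceBits x)
        (fun x => isIsometryMatrix_denseEncode _) q', ?_, fun x y p => ?_⟩
    · rw [QuantumProtocol.cost, hc', QuantumProtocol.cost_swap, hc]
    · rw [QuantumProtocol.acceptProb, hq']
      simp only [denseDecode_denseEncode]
      set r : (H × Bool × Bool) → ℂ := fun c =>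
        if c.2 = (T c.1).aliceBits x then (√2 : ℝ) * p c.1 else 0
      have h := QuantumProtocol.acceptProb_swap q y x (diagState fun c => r c.1)
      rw [hq y x r] at h
      refine Eq.trans ?_ (h.trans ?_)
      · congr 1
        funext a b
        exact diagState_comm _ _ _
      · simp only [DetProtocol.eval_swap]
        rw [Fintype.sum_prod_type, Fintype.card_prod, Fintype.card_bool]
        push_cast
        rw [mul_comm 2, mul_assoc]
        congr 1
        rw [Finset.mul_sum]
        refine Finset.sum_congr rfl fun h _ => ?_
        rw [Finset.sum_eq_single ((T h).aliceBits x) (fun m _ hm => by simp [r, hm]) (by simp),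
          eval_afterAliceBits]
        split_ifs
        · simp [r, mul_pow]
        · simp

theorem exists_entangledProtocol {X Y : Type} (p : PublicCoinProtocol X Y) :
    ∃ q : EntangledProtocol X Y, q.cost = p.cost ∧ q.acceptProb = p.acceptProb := by
  obtain ⟨E, _, _, q, hc, hq⟩ := DetProtocol.exists_quantumProtocol p.cost p.tree fun i =>
    .inl (Finset.le_sup (f := fun i => (p.tree i).cost) (Finset.mem_univ i))
  have hE : (0 : ℝ) < Fintype.card E := by exact_mod_cast Fintype.card_pos
  -- Dividing by the size of `E` normalizes the state, as each coin outcome occurs with every index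
  -- of the maximally entangled part.
  let r : Fin p.size → ℂ := fun i => (√(p.prob i / Fintype.card E) : ℝ)
  have hr : ∀ i, ‖r i‖ ^ 2 = p.prob i / Fintype.card E := fun i => by
    rw [Complex.norm_real, Real.norm_eq_abs, sq_abs,
      Real.sq_sqrt (div_nonneg (p.prob_mem.1 i) hE.le)]
  refine ⟨{ A := Fin p.size × E, B := Fin p.size × E, ψ := diagState fun a => r a.1,
            norm_eq_one := ?_, interaction := q }, hc, ?_⟩
  · have h : ∀ a : Fin p.size × E, (∑ b, ‖diagState (fun a => r a.1) a b‖ ^ 2) =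
        p.prob a.1 / Fintype.card E := by
      intro a
      rw [Finset.sum_eq_single a (fun b _ hb => by simp [diagState, Ne.symm hb]) (by simp)]
      simp [diagState, hr]
    simp only [h]
    rw [Fintype.sum_prod_type]
    simp only [Finset.sum_const, Finset.card_univ, nsmul_eq_mul, mul_div_cancel₀ _ hE.ne']
    exact p.prob_mem.2
  · funext x y
    refine (hq x y r).trans ?_
    unfold PublicCoinProtocol.acceptProb
    rw [Finset.mul_sum]
    refine Finset.sum_congr rfl fun (i : Fin p.size) _ => ?_
    rw [hr]
    split_ifs
    · field_simp
    · simp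

end Isometry

/-! ### Comparison of the measures -/

section Comparison

variable {X Y : Type}

theorem entangledCosts_nonempty [Finite X] {ε : ℝ} (h0 : 0 ≤ ε) (h1 : ε ≤ 1)
    (f : X → Y → Bool) : (entangledCosts ε f).Nonempty := by
  obtain ⟨_, p, hp, -⟩ := publicCoinCosts_nonempty h0 h1 f
  obtain ⟨q, -, hq⟩ := exists_entangledProtocol p
  exact ⟨_, q, hq ▸ hp, rfl⟩

theorem exactQstar_le_exactRpub [Finite X] {ε : ℝ} (h0 : 0 ≤ ε) (h1 : ε ≤ 1)
    (f : X → Y → Bool) : exactQstar ε f ≤ exactRpub ε f := by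
  obtain ⟨p, hp, hc⟩ := Nat.sInf_mem (publicCoinCosts_nonempty h0 h1 f)
  obtain ⟨q, hqc, hq⟩ := exists_entangledProtocol p
  exact Nat.sInf_le ⟨q, hq ▸ hp, hqc.trans hc⟩

theorem gammaTwo_le_two_pow_exactQstar [Finite X] [Finite Y] {ε : ℝ} (h0 : 0 ≤ ε) (h1 : ε ≤ 1)
    (f : X → Y → Bool) : gammaTwo (commMatrix ε (1 - ε) f) ≤ 2 ^ exactQstar ε f := by
  obtain ⟨q, hq, hc⟩ := Nat.sInf_mem (entangledCosts_nonempty h0 h1 f)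
  have h : commMatrix ε (1 - ε) f = Matrix.of q.acceptProb := by
    ext x y
    exact (hq x y).symm
  rw [h, exactQstar, ← hc]
  exact q.gammaTwo_acceptProb_le

/-- Subtracting `ε` from the acceptance probabilities and dividing by `1 - 2 * ε` gives the Boolean
matrix; the extra `ε` is absorbed since `1 ≤ 2 ^ Q`. -/
theorem gammaTwo_boolean_le_exactQstar [Finite X] [Finite Y] {ε : ℝ} (h0 : 0 < ε) (h1 : ε < 1 / 2)
    (f : X → Y → Bool) :
    gammaTwo (commMatrix 0 1 f) ≤ 2 / (1 - 2 * ε) * 2 ^ exactQstar ε f := by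
  have hε : 0 < 1 - 2 * ε := by linarith
  have h := gammaTwo_affine_le (M := commMatrix ε (1 - ε) f) (N := commMatrix 0 1 f)
    (1 / (1 - 2 * ε)) (-(ε / (1 - 2 * ε))) fun x y => by
      simp only [commMatrix, Matrix.of_apply]
      split_ifs <;> field_simp <;> ring
  rw [abs_neg, abs_of_pos (by positivity), abs_of_pos (by positivity)] at h
  have h2 := gammaTwo_le_two_pow_exactQstar h0.le (by linarith) f
  have h3 : (1 : ℝ) ≤ 2 ^ exactQstar ε f := one_le_pow₀ one_le_two
  calc _ ≤ _ := h
    _ = (gammaTwo (commMatrix ε (1 - ε) f) + ε) / (1 - 2 * ε) := by ring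
    _ ≤ (2 * 2 ^ exactQstar ε f) / (1 - 2 * ε) := by gcongr; linarith
    _ = _ := by ring

theorem gammaTwo_sign_le_exactQstar [Finite X] [Finite Y] {ε : ℝ} (h0 : 0 < ε) (h1 : ε < 1 / 2)
    (f : X → Y → Bool) :
    gammaTwo (commMatrix 1 (-1) f) ≤ 5 / (1 - 2 * ε) * 2 ^ exactQstar ε f := by
  have hε : 0 < 1 - 2 * ε := by linarith
  have h := gammaTwo_boolean_le_exactQstar h0 h1 f
  have h3 : (1 : ℝ) ≤ 2 ^ exactQstar ε f := one_le_pow₀ one_le_two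
  have h4 : 1 ≤ 1 / (1 - 2 * ε) := by rw [le_div_iff₀ hε]; linarith
  calc _ ≤ 2 * gammaTwo (commMatrix 0 1 f) + 1 := gammaTwo_sign_le f
    _ ≤ 2 * (2 / (1 - 2 * ε) * 2 ^ exactQstar ε f) + 1 / (1 - 2 * ε) * 2 ^ exactQstar ε f := by
      gcongr
      nlinarith
    _ = _ := by ring

end Comparison

theorem isBigO_one_of_nonneg {u : ℕ → ℝ} (hu : ∀ n, 0 ≤ u n) :
    u =O[atTop] (fun _ => (1 : ℝ)) ↔ ∃ B, ∀ᶠ n in atTop, u n ≤ B := by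
  rw [isBigO_iff]
  simp [abs_of_nonneg (hu _)]

end CommComplexity

open CommComplexity in
theorem mainTheorem3 (ε : ℝ) (hε₀ : 0 < ε) (hε₁ : ε < 1 / 2) :
    -- the minima defining the complexities exist, and the parts of the cycle without constants
    (∀ (X Y : Type) [Finite X] [Finite Y] (f : X → Y → Bool),
      (publicCoinCosts ε f).Nonempty ∧ (entangledCosts ε f).Nonempty ∧
      exactQstar ε f ≤ exactRpub ε f ∧
      gammaTwo (commMatrix ε (1 - ε) f) ≤ 2 ^ exactQstar ε f) ∧
    -- the parts of the cycle with a constant that depends on `ε` only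
    (∃ C : ℝ, 0 < C ∧ ∀ (X Y : Type) [Finite X] [Finite Y] (f : X → Y → Bool),
      (exactRpub ε f : ℝ) ≤ C * gammaTwo (commMatrix 0 1 f) ^ 2 ∧
      (exactRpub ε f : ℝ) ≤ C * gammaTwo (commMatrix 1 (-1) f) ^ 2 ∧
      gammaTwo (commMatrix 0 1 f) ≤ C * 2 ^ exactQstar ε f ∧
      gammaTwo (commMatrix 1 (-1) f) ≤ C * 2 ^ exactQstar ε f) ∧
    -- constant-equivalence, for families of total Boolean functions
    (∀ f : ∀ n : ℕ, (Fin n → Bool) → (Fin n → Bool) → Bool,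
      List.TFAE [
        (fun n => gammaTwo (commMatrix 0 1 (f n))) =O[atTop] (fun _ => (1 : ℝ)),
        (fun n => gammaTwo (commMatrix 1 (-1) (f n))) =O[atTop] (fun _ => (1 : ℝ)),
        (fun n => (exactRpub ε (f n) : ℝ)) =O[atTop] (fun _ => (1 : ℝ)),
        (fun n => (exactQstar ε (f n) : ℝ)) =O[atTop] (fun _ => (1 : ℝ))]) := by
  have hε : 0 < 1 - 2 * ε := by linarith
  have h1 : ε ≤ 1 := by linarith
  have part2 : ∃ C : ℝ, 0 < C ∧ ∀ (X Y : Type) [Finite X] [Finite Y] (f : X → Y → Bool),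
      (exactRpub ε f : ℝ) ≤ C * gammaTwo (commMatrix 0 1 f) ^ 2 ∧
      (exactRpub ε f : ℝ) ≤ C * gammaTwo (commMatrix 1 (-1) f) ^ 2 ∧
      gammaTwo (commMatrix 0 1 f) ≤ C * 2 ^ exactQstar ε f ∧
      gammaTwo (commMatrix 1 (-1) f) ≤ C * 2 ^ exactQstar ε f := by
    have hK : 0 < 160000 / ε + 4 := by positivity
    have hL : 0 < 1 / (1 - 2 * ε) := by positivity
    set K := 160000 / ε + 4
    set L := 1 / (1 - 2 * ε) with hLdef
    have e2 : 2 / (1 - 2 * ε) = 2 * L := by rw [hLdef]; ring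
    have e5 : 5 / (1 - 2 * ε) = 5 * L := by rw [hLdef]; ring
    -- The four constants are `9 * K`, `K`, `2 * L` and `5 * L`; one sum dominates them all.
    refine ⟨9 * K + 5 * L, by positivity, fun X Y _ _ f => ⟨?_, ?_, ?_, ?_⟩⟩
    · exact (exactRpub_le_boolean hε₀ hε₁ f).trans
        (mul_le_mul_of_nonneg_right (by linarith) (sq_nonneg _))
    · exact (exactRpub_le_sign hε₀ hε₁ f).trans
        (mul_le_mul_of_nonneg_right (by linarith) (sq_nonneg _))
    · exact (gammaTwo_boolean_le_exactQstar hε₀ hε₁ f).trans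
        (mul_le_mul_of_nonneg_right (by linarith) (by positivity))
    · exact (gammaTwo_sign_le_exactQstar hε₀ hε₁ f).trans
        (mul_le_mul_of_nonneg_right (by linarith) (by positivity))
  refine ⟨fun X Y _ _ f => ⟨publicCoinCosts_nonempty hε₀.le h1 f,
    entangledCosts_nonempty hε₀.le h1 f, exactQstar_le_exactRpub hε₀.le h1 f,
    gammaTwo_le_two_pow_exactQstar hε₀.le h1 f⟩, part2, fun f => ?_⟩
  obtain ⟨C, hC, hf⟩ := part2
  rw [isBigO_one_of_nonneg fun n => gammaTwo_nonneg _,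
    isBigO_one_of_nonneg fun n => gammaTwo_nonneg _,
    isBigO_one_of_nonneg fun n => Nat.cast_nonneg _,
    isBigO_one_of_nonneg fun n => Nat.cast_nonneg _]
  have hpow : ∀ {B : ℝ} {q : ℕ}, (q : ℝ) ≤ B → (2 : ℝ) ^ q ≤ 2 ^ ⌊B⌋₊ := fun h =>
    pow_le_pow_right₀ one_le_two (Nat.le_floor h)
  tfae_have 1 → 3
  | ⟨B, hB⟩ => ⟨C * B ^ 2, hB.mono fun n hn => (hf _ _ (f n)).1.trans (by
      have := gammaTwo_nonneg (commMatrix 0 1 (f n)); gcongr)⟩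
  tfae_have 2 → 3
  | ⟨B, hB⟩ => ⟨C * B ^ 2, hB.mono fun n hn => (hf _ _ (f n)).2.1.trans (by
      have := gammaTwo_nonneg (commMatrix 1 (-1) (f n)); gcongr)⟩
  tfae_have 3 → 4
  | ⟨B, hB⟩ => ⟨B, hB.mono fun n hn => le_trans
      (Nat.cast_le.2 (exactQstar_le_exactRpub hε₀.le h1 (f n))) hn⟩
  tfae_have 4 → 1
  | ⟨B, hB⟩ => ⟨C * 2 ^ ⌊B⌋₊, hB.mono fun n hn => (hf _ _ (f n)).2.2.1.trans
      (mul_le_mul_of_nonneg_left (hpow hn) hC.le)⟩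
  tfae_have 4 → 2
  | ⟨B, hB⟩ => ⟨C * 2 ^ ⌊B⌋₊, hB.mono fun n hn => (hf _ _ (f n)).2.2.2.trans
      (mul_le_mul_of_nonneg_left (hpow hn) hC.le)⟩
  tfae_finish
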